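/- **Notation.** For $n\ge 1$ let $P_n=\mathbb Z^n$ be the weight lattice of $\mathfrak{sp}_{2n}$, with basis $\varepsilon_{\overline n},\dots,\varepsilon_{\overline 1}$; write $\beta=(\beta_{\overline n},\dots,\beta_{\overline 1})$ for a weight, and let $P_n^+$ be the set of $\beta\in P_n$ with $\beta_{\overline n}\ge\cdots\ge\beta_{\overline 1}\ge 0$. The positive roots are $R_n^+=\{\varepsilon_{\overline i}\pm\varepsilon_{\overline j}: 1\le j<i\le n\}\cup\{2\varepsilon_{\overline i}:1\le i\le n\}$, $\rho=(n,n-1,\dots,1)$, and $W_n$ is the Weyl group, with length function $l$ relative to the simple reflections. Define $\mathcal P_q(\beta)$ by $$\prod_{\alpha\in R_n^+}\frac1{1-qx^\alpha}=\sum_{\beta\in P_n}\mathcal P_q(\beta)x^\beta,$$ and for $\lambda,\mu\in P_n^+$ let $$K_{\lambda,\mu}(q)=\sum_{\sigma\in W_n}(-1)^{l(\sigma)}\mathcal P_q\bigl(\sigma(\lambda+\rho)-(\mu+\rho)\bigr)$$ be the Kostka–Foulkes polynomial of type $C_n$. For $\beta\in P_n$ put $a_\beta=\sum_{\sigma\in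 W_n}(-1)^{l(\sigma)}x^{\sigma(\beta)}$ and $s_\beta=a_{\beta+\rho}/a_\rho$, and define the Hall–Littlewood function $$Q_\beta=\Bigl(\prod_{\alpha\in R_n^+}\frac1{1-qR_\alpha}\Bigr)s_\beta=\sum_{(k_\alpha)\in\mathbb N^{R_n^+}}q^{\sum_\alpha k_\alpha}\,s_{\beta+\sum_\alpha k_\alpha\alpha},$$ a formal power series in $q$. For $\lambda\in P_n^+$ let $B(\lambda)$ be the crystal graph of the irreducible $U_q(\mathfrak{sp}_{2n})$-module with highest weight $\lambda$, and let $(r)_n=(r,0,\dots,0)\in P_n^+$. A sum over $\lambda\in B(\gamma)\otimes B((r)_n)$ runs over the irreducible components of the crystal $B(\gamma)\otimes B((r)_n)$, each component isomorphic to $B(\lambda)$ contributing the term for $\lambda$; thus $\lambda$ is counted with its multiplicity. **Theorem.** Let $n\ge2$ and $\mu\in P_n^+$, and write $\mu=(\mu_{\overline n},\mu')$ where $\mu_{\overline n}$ is the first part of $\mu$ and $\mu'=(\mu_{\overline{n-1}},\dots,\mu_{\overline 1})\in P_{n-1}^+$. Then $$Q_\mu=\sum_{\gamma\in P_{n-1}^+}\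 \sum_{r=0}^{\infty}\ \sum_{m=0}^{\infty}q^{m+r}\sum_{\lambda\in B(\gamma)\otimes B((r)_{n-1})}K_{\lambda,\mu'}(q)\,s_{(\mu_{\overline n}+r+2m,\ \gamma)},$$ where the $K_{\lambda,\mu'}(q)$ are Kostka–Foulkes polynomials of type $C_{n-1}$, the $s$ are Schur functions of type $C_n$, and the identity is one of formal power series in $q$: for each $N$, only finitely many triples $(\gamma,r,m)$ contribute to the coefficient of $q^N$ on the right-hand side, and the coefficients of $q^N$ on both sides agree. -/

import Mathlib

/-!
Type `C_n`: weights, Weyl group, Kostka-Foulkes polynomials, symplectic Schur functions,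
Hall-Littlewood functions, and crystal graphs.

Conventions.  The weight lattice `P_n` is `ℤ^n`, realised as `Fin n → ℤ`; the entry with index `i`
is the coordinate on `ε_{\overline{i+1}}`.  Hence the tuple written
`(β_{\overline n}, …, β_{\overline 1})` on paper is `(β (n-1), …, β 0)` here, and
`(b, β')` with `β'` a weight of type `C_n` is `Fin.snoc β' b`, a weight of type `C_{n+1}`.
-/

noncomputable section

namespace TypeC

/-! ### Weights and roots -/

/-- The weight lattice of `sp_{2n}`. -/
abbrev Weight (n : ℕ) : Type := Fin n → ℤ

/-- The basis vector `ε_{\overline{i+1}}`. -/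
def basisVec {n : ℕ} (i : Fin n) : Weight n := Pi.single i 1

/-- The fundamental weight `Λ_i = ε_{\overline n} + ⋯ + ε_{\overline{i+1}}`, `0 ≤ i ≤ n - 1`. -/
def fundWeight {n : ℕ} (i : Fin n) : Weight n := fun j => if i ≤ j then 1 else 0

/-- Dominance: `β_{\overline n} ≥ ⋯ ≥ β_{\overline 1} ≥ 0`. -/
def IsDominant {n : ℕ} (β : Weight n) : Prop := Monotone β ∧ ∀ i, 0 ≤ β i

/-- The set `P_n^+` of dominant weights. -/
abbrev DominantWeight (n : ℕ) : Type := {β : Weight n // IsDominant β}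

/-- The row partition `(r, 0, …, 0)` of length `n`. -/
def rowWeight (n : ℕ) (r : ℕ) : Weight n := fun j => if (j : ℕ) + 1 = n then (r : ℤ) else 0

/-- The half sum of the positive roots, `ρ = (n, n - 1, …, 1)`. -/
def rho (n : ℕ) : Weight n := fun j => (j : ℤ) + 1

/-- The positive roots `ε_{\overline i} ± ε_{\overline j}` (`j < i`) and `2 ε_{\overline i}`. -/
def posRoots (n : ℕ) : Finset (Weight n) :=
  ((Finset.univ : Finset (Fin n × Fin n)).filter fun p => p.2 < p.1).image
      (fun p => basisVec p.1 - basisVec p.2) ∪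
    ((Finset.univ : Finset (Fin n × Fin n)).filter fun p => p.2 < p.1).image
      (fun p => basisVec p.1 + basisVec p.2) ∪
    (Finset.univ : Finset (Fin n)).image (fun i => (2 : ℤ) • basisVec i)

/-! ### The Weyl group -/

/-- The alphabet `\{\overline n < ⋯ < \overline 1 < 1 < ⋯ < n\}`:
`Sum.inl i` is the barred letter `\overline{i+1}` and `Sum.inr i` is the letter `i+1`. -/
abbrev Letter (n : ℕ) : Type := Fin n ⊕ Fin n

/-- The index before `i` (only used when `i ≠ 0`). -/
def predIdx {n : ℕ} (i : Fin n) : Fin n := ⟨(i : ℕ) - 1, lt_of_le_of_lt (Nat.sub_le _ _) i.isLt⟩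

/-- The generators: `s_0 = (1, \overline 1)` and
`s_i = (i, i+1)(\overline i, \overline{i+1})` for `1 ≤ i ≤ n - 1`. -/
def simpleRefl {n : ℕ} (i : Fin n) : Equiv.Perm (Letter n) :=
  if (i : ℕ) = 0 then Equiv.swap (Sum.inr i) (Sum.inl i)
  else Equiv.swap (Sum.inr (predIdx i)) (Sum.inr i) * Equiv.swap (Sum.inl (predIdx i)) (Sum.inl i)

/-- The Weyl group `W_n`, as the group of permutations of the alphabet generated by the `s_i`. -/
def weylGroup (n : ℕ) : Subgroup (Equiv.Perm (Letter n)) :=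
  Subgroup.closure (Set.range simpleRefl)

instance (n : ℕ) : Fintype (weylGroup n) := Fintype.ofFinite _

/-- The length of `σ` with respect to the generators `s_0, …, s_{n-1}`. -/
def len {n : ℕ} (σ : weylGroup n) : ℕ :=
  sInf {k | ∃ L : List (Fin n), L.length = k ∧ (L.map simpleRefl).prod = (σ : Equiv.Perm (Letter n))}

/-- The sign `(-1)^{l(σ)}`. -/
def sgn {n : ℕ} (σ : weylGroup n) : ℤ := (-1) ^ len σ

/-- The action of `σ` on weights: the coordinate of `σ · β` at `\overline i` is
`β_{σ(\overline i)}` if `σ(\overline i)` is barred, and `-β_{σ(i)}` otherwise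
(in the second case `σ(i)` is the barred letter `\overline{σ(\overline i)}`). -/
def act {n : ℕ} (σ : weylGroup n) (β : Weight n) : Weight n := fun i =>
  match (σ : Equiv.Perm (Letter n)) (Sum.inl i) with
  | Sum.inl j => β j
  | Sum.inr j => -β j

/-! ### Kostka-Foulkes polynomials -/

/-- The group ring `ℤ[P_n]`. -/
abbrev GroupRing (n : ℕ) : Type := AddMonoidAlgebra ℤ (Weight n)

/-- The monomial `x^β`. -/
def xpow {n : ℕ} (β : Weight n) : GroupRing n := AddMonoidAlgebra.single β 1

/-- The product `∏_{α > 0} 1 / (1 - q x^α)`, as a power series in `q` over `ℤ[P_n]`. -/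
def kostantSeries (n : ℕ) : PowerSeries (GroupRing n) :=
  ∏ α ∈ posRoots n, PowerSeries.invOfUnit (1 - PowerSeries.X * PowerSeries.C (xpow α)) 1

/-- The `q`-analogue `𝒫_q(β)` of Kostant's partition function: the coefficient of `x^β` in
`∏_{α > 0} 1 / (1 - q x^α)`. -/
def qPartition {n : ℕ} (β : Weight n) : PowerSeries ℤ :=
  PowerSeries.mk fun N => (PowerSeries.coeff N (kostantSeries n)).coeff β

/-- The Kostka-Foulkes polynomial
`K_{λ,μ}(q) = ∑_{σ ∈ W_n} (-1)^{l(σ)} 𝒫_q(σ(λ + ρ) - (μ + ρ))`, seen in `ℤ⟦q⟧`. -/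
def kostkaFoulkes {n : ℕ} (lam mu : Weight n) : PowerSeries ℤ :=
  ∑ σ : weylGroup n, sgn σ • qPartition (act σ (lam + rho n) - (mu + rho n))

/-! ### Schur functions and Hall-Littlewood functions -/

/-- The alternant `a_β = ∑_{σ ∈ W_n} (-1)^{l(σ)} x^{σ(β)}`. -/
def alternant {n : ℕ} (β : Weight n) : GroupRing n :=
  ∑ σ : weylGroup n, sgn σ • xpow (act σ β)

/-- The field of fractions of `ℤ[P_n]`, in which the quotients of alternants are formed. -/
abbrev FracField (n : ℕ) : Type := FractionRing (GroupRing n)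

/-- The Schur function `s_β = a_{β + ρ} / a_ρ`, for an arbitrary weight `β`. -/
def schur {n : ℕ} (β : Weight n) : FracField n :=
  algebraMap (GroupRing n) (FracField n) (alternant (β + rho n)) /
    algebraMap (GroupRing n) (FracField n) (alternant (rho n))

/-- The Hall-Littlewood function `Q_β = (∏_{α > 0} 1 / (1 - q R_α)) s_β`, where the raising operators
`R_α` act on the index of `s`.  Expanding the geometric series `1 / (1 - q R_α) = ∑_k q^k R_α^k`,
the coefficient of `q^N` is the sum of the `s_{β + ∑_α k_α α}` over all families `(k_α)` of
natural numbers with `∑_α k_α = N`. -/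
def hallLittlewood {n : ℕ} (β : Weight n) : PowerSeries (FracField n) :=
  PowerSeries.mk fun N =>
    ∑ k ∈ Finset.piAntidiag (posRoots n) N, schur (β + ∑ α ∈ posRoots n, k α • α)

/-- `F` is the sum of the family `f` of power series in `q`: each power of `q` occurs in finitely
many members of the family only, and the coefficients add up. -/
def HasFormalSum {ι A : Type*} [CommRing A] (f : ι → PowerSeries A) (F : PowerSeries A) : Prop :=
  ∀ N : ℕ, {t | PowerSeries.coeff N (f t) ≠ 0}.Finite ∧
    PowerSeries.coeff N F = ∑ᶠ t, PowerSeries.coeff N (f t)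

/-! ### Crystal graphs -/

/-- An oriented coloured graph on the vertex set `B` with colours in `I`, given by the operators
`f̃_i` and `ẽ_i`; the value `none` stands for `0`. -/
structure CrystalOps (I B : Type) where
  f : I → B → Option B
  e : I → B → Option B

namespace CrystalOps

variable {I B B' : Type}

/-- The `k`-th iterate of an operator, with `0 ↦ 0`. -/
def iter (g : B → Option B) (k : ℕ) (b : B) : Option B := (fun o => o.bind g)^[k] (some b)

/-- `ε_i(b) = max {k ; ẽ_i^k(b) ≠ 0}`. -/
def eps (C : CrystalOps I B) (i : I) (b : B) : ℕ := sSup {k | iter (C.e i) k b ≠ none}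

/-- `φ_i(b) = max {k ; f̃_i^k(b) ≠ 0}`. -/
def phi (C : CrystalOps I B) (i : I) (b : B) : ℕ := sSup {k | iter (C.f i) k b ≠ none}

/-- The tensor product of two crystal graphs. -/
def tensor (C : CrystalOps I B) (C' : CrystalOps I B') : CrystalOps I (B × B') where
  f i p := if C'.eps i p.2 < C.phi i p.1 then (C.f i p.1).map fun u => (u, p.2)
    else (C'.f i p.2).map fun v => (p.1, v)
  e i p := if C.phi i p.1 < C'.eps i p.2 then (C'.e i p.2).map fun v => (p.1, v)
    else (C.e i p.1).map fun u => (u, p.2)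

/-- Highest weight vertices: `ẽ_i(b) = 0` for all `i`. -/
def IsHighestWeight (C : CrystalOps I B) (b : B) : Prop := ∀ i, C.e i b = none

/-- The weight `wt(b) = ∑_i (φ_i(b) - ε_i(b)) Λ_i`. -/
def wt {n : ℕ} (C : CrystalOps (Fin n) B) (b : B) : Weight n :=
  ∑ i : Fin n, ((C.phi i b : ℤ) - (C.eps i b : ℤ)) • fundWeight i

/-- The vertices obtained from `b₀` by applying the operators `f̃_i` repeatedly. -/
inductive Generated (C : CrystalOps I B) (b₀ : B) : B → Prop
  | base : Generated C b₀ b₀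
  | step {i : I} {b b' : B} : Generated C b₀ b → C.f i b = some b' → Generated C b₀ b'

end CrystalOps

/-- The crystal graph of the vector representation,
`\overline n → ⋯ → \overline 1 → 1 → ⋯ → n`, the arrow `\overline{i+1} → \overline i` and the
arrow `i → i+1` having colour `i` (`1 ≤ i ≤ n - 1`) and `\overline 1 → 1` having colour `0`. -/
def vectorCrystal (n : ℕ) : CrystalOps (Fin n) (Letter n) where
  f i x :=
    if (i : ℕ) = 0 then (if x = Sum.inl i then some (Sum.inr i) else none)
    else if x = Sum.inl i then some (Sum.inl (predIdx i))
    else if x = Sum.inr (predIdx i) then some (Sum.inr i)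
    else none
  e i x :=
    if (i : ℕ) = 0 then (if x = Sum.inr i then some (Sum.inl i) else none)
    else if x = Sum.inl (predIdx i) then some (Sum.inl i)
    else if x = Sum.inr i then some (Sum.inr (predIdx i))
    else none

/-- Words with `l` letters in `X`. -/
def Word (X : Type) : ℕ → Type
  | 0 => Unit
  | l + 1 => X × Word X l

/-- The word of a list of letters. -/
def Word.ofList {X : Type} : (w : List X) → Word X w.length
  | [] => ()
  | a :: w => (a, Word.ofList w)

/-- The crystal graph of the `l`-th tensor power of the vector representation; its vertices are
the words with `l` letters. -/
def wordCrystal (n : ℕ) : (l : ℕ) → CrystalOps (Fin n) (Word (Letter n) l)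
  | 0 => { f := fun _ _ => none, e := fun _ _ => none }
  | l + 1 => (vectorCrystal n).tensor (wordCrystal n l)

/-- The word `\overline n \overline{n-1} ⋯ \overline{p+1}`, the highest weight vertex of
`B(Λ_p)`. -/
def hwColumn {n : ℕ} (p : Fin n) : List (Letter n) :=
  ((List.finRange n).reverse.filter fun j => p ≤ j).map Sum.inl

/-- The coefficient of `β` on `Λ_p`: it is `β_{\overline 1}` for `p = 0` and
`β_{\overline{p+1}} - β_{\overline p}` otherwise. -/
def fundCoeff {n : ℕ} (β : Weight n) (p : Fin n) : ℤ :=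
  if (p : ℕ) = 0 then β p else β p - β (predIdx p)

/-- The word `b_β = b_{n-1}^{⊗ \hat β_{n-1}} ⊗ ⋯ ⊗ b_0^{⊗ \hat β_0}`, where
`β = ∑_p \hat β_p Λ_p` is dominant and `b_p` is the highest weight vertex of `B(Λ_p)`. -/
def hwWord {n : ℕ} (β : Weight n) : List (Letter n) :=
  (List.finRange n).reverse.flatMap fun p =>
    (List.replicate (fundCoeff β p).toNat (hwColumn p)).flatten

/-- The crystal graph in which `B(β)` is realised: a tensor power of the vector crystal. -/
abbrev ambient {n : ℕ} (β : Weight n) :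
    CrystalOps (Fin n) (Word (Letter n) (hwWord β).length) :=
  wordCrystal n (hwWord β).length

/-- The vertices of the crystal `B(β)` of the irreducible module with highest weight `β`: all the
nonzero `f̃_{i_1} ⋯ f̃_{i_k} b_β`. -/
def crystalB {n : ℕ} (β : Weight n) : Set (Word (Letter n) (hwWord β).length) :=
  {w | (ambient β).Generated (Word.ofList (hwWord β)) w}

/-- The highest weight vertices of `B(β) ⊗ B(β')`.  Each irreducible (that is, connected) component
of `B(β) ⊗ B(β')` contains exactly one of them, and is a copy of `B(λ)` for `λ` the weight of that
vertex. -/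
def componentVertices {n : ℕ} (β β' : Weight n) :
    Set (Word (Letter n) (hwWord β).length × Word (Letter n) (hwWord β').length) :=
  {b | b.1 ∈ crystalB β ∧ b.2 ∈ crystalB β' ∧
    ((ambient β).tensor (ambient β')).IsHighestWeight b}

/-- The sum `∑_{λ ∈ B(β) ⊗ B(β')} g(λ)`: each irreducible component of `B(β) ⊗ B(β')` isomorphic to
`B(λ)` contributes `g(λ)`, so `λ` is counted with the multiplicity of `B(λ)`. -/
def sumOverComponents {n : ℕ} {A : Type*} [AddCommMonoid A] (β β' : Weight n)
    (g : Weight n → A) : A :=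
  ∑ᶠ b ∈ componentVertices β β', g (((ambient β).tensor (ambient β')).wt b)

end TypeC

end

open TypeC

noncomputable section

namespace TypeC

/-! ### Signed permutations -/

-- The positive roots of `C_{n+1}` are those of `C_n`, the long root `2ε`, and the sums `ε + wt(x)`,
-- where `ε` is the new basis vector and `x` runs over the letters of the vector representation of
-- `sp_{2n}`. Sorting the coefficient of `q^N` in `Q_μ` by the exponent `m` of the long root and the
-- total exponent `r` of the roots `ε + wt(x)` gives terms `s_{(d, μ' + β + wt k)}` with `d =
-- μ_{\overline n} + r + 2m`. Here `k` is a multiset of `r` letters and `β` is weighted by the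
-- coefficient of `q^{N-m-r}` in the Kostant series of `C_n` (`coeff_hallLittlewood_succ`).
--
-- For fixed `d`, the function `β ↦ s_{(d, β)}` is antisymmetric under the dot action of `W_n`, so
-- the sum folds onto dominant `γ` (`finsum_eq_finsum_dominant`). The letter weights are permuted by
-- `W_n`, hence the coefficient of `s_{(d, γ)}` is `∑_k K_{γ + wt k, μ'}`, with `K` extended to all
-- weights by its alternating sum (`linExt_eq_finsum_dominant`).
--
-- What remains is a Pieri rule: for every antisymmetric `g`, `∑_k g(γ + wt k + ρ)` equals the sum
-- of `g(λ + ρ)` over the components of `B(γ) ⊗ B((r))`; it is applied to `K`. On the side of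
-- weights, the multisets violating an inequality at some node `i` cancel under involutions lifting
-- `s_i` (`sum_countWeight_eq_sum_isPieri`). On the side of crystals, `B((r))` consists of the
-- weakly decreasing words, one for each multiset, and `b_γ ⊗ w` is a highest weight vertex iff
-- `ε_i(w) ≤ ⟨γ, α_i^∨⟩` for all `i`; these are exactly the surviving inequalities
-- (`mem_componentVertices_iff`).

/-- The odd extension of a weight to the alphabet. -/
def oddExt {n : ℕ} (β : Weight n) : Letter n → ℤ := Sum.elim β (fun j => -β j)

theorem oddExt_swap {n : ℕ} (β : Weight n) (x : Letter n) : oddExt β x.swap = -oddExt β x := by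
  cases x <;> simp [oddExt]

theorem act_apply {n : ℕ} (σ : weylGroup n) (β : Weight n) (i : Fin n) :
    act σ β i = oddExt β ((σ : Equiv.Perm (Letter n)) (Sum.inl i)) := by
  unfold act
  split <;> simp_all [oddExt]

theorem simpleRefl_zero {n : ℕ} (i : Fin n) (hi : (i : ℕ) = 0) :
    simpleRefl i = Equiv.swap (Sum.inr i) (Sum.inl i) := by
  simp [simpleRefl, hi]

theorem simpleRefl_pos {n : ℕ} (i : Fin n) (hi : (i : ℕ) ≠ 0) :
    simpleRefl i = Equiv.swap (Sum.inr (predIdx i)) (Sum.inr i) *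
      Equiv.swap (Sum.inl (predIdx i)) (Sum.inl i) := by
  simp [simpleRefl, hi]

theorem predIdx_ne {n : ℕ} {i : Fin n} (hi : (i : ℕ) ≠ 0) : predIdx i ≠ i := by
  intro h
  have := congrArg Fin.val h
  simp only [predIdx] at this
  omega

theorem simpleRefl_zero_inl {n : ℕ} (i : Fin n) (hi : (i : ℕ) = 0) (j : Fin n) :
    simpleRefl i (Sum.inl j) = if j = i then Sum.inr i else Sum.inl j := by
  rw [simpleRefl_zero i hi, Equiv.swap_apply_def]
  simp

theorem simpleRefl_zero_inr {n : ℕ} (i : Fin n) (hi : (i : ℕ) = 0) (j : Fin n) :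
    simpleRefl i (Sum.inr j) = if j = i then Sum.inl i else Sum.inr j := by
  rw [simpleRefl_zero i hi, Equiv.swap_apply_def]
  simp

theorem simpleRefl_pos_inl {n : ℕ} (i : Fin n) (hi : (i : ℕ) ≠ 0) (j : Fin n) :
    simpleRefl i (Sum.inl j) = Sum.inl (Equiv.swap (predIdx i) i j) := by
  rw [simpleRefl_pos i hi]
  simp only [Equiv.Perm.mul_apply, Equiv.swap_apply_def, Sum.inl.injEq]
  split_ifs <;> simp_all

theorem simpleRefl_pos_inr {n : ℕ} (i : Fin n) (hi : (i : ℕ) ≠ 0) (j : Fin n) :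
    simpleRefl i (Sum.inr j) = Sum.inr (Equiv.swap (predIdx i) i j) := by
  rw [simpleRefl_pos i hi]
  simp only [Equiv.Perm.mul_apply, Equiv.swap_apply_def, Sum.inr.injEq, reduceCtorEq, if_false]
  split_ifs <;> simp

theorem simpleRefl_swap {n : ℕ} (i : Fin n) (x : Letter n) :
    simpleRefl i x.swap = (simpleRefl i x).swap := by
  by_cases hi : (i : ℕ) = 0
  · cases x <;> simp only [Sum.swap_inl, Sum.swap_inr, simpleRefl_zero_inl i hi,
      simpleRefl_zero_inr i hi] <;> split_ifs <;> rfl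
  · cases x <;> simp [simpleRefl_pos_inl i hi, simpleRefl_pos_inr i hi]

theorem simpleRefl_mul_self {n : ℕ} (i : Fin n) : simpleRefl i * simpleRefl i = 1 := by
  ext x : 1
  by_cases hi : (i : ℕ) = 0
  · rw [simpleRefl_zero i hi]; simp
  · cases x <;> simp [simpleRefl_pos_inl i hi, simpleRefl_pos_inr i hi]

theorem simpleRefl_mem {n : ℕ} (i : Fin n) : simpleRefl i ∈ weylGroup n :=
  Subgroup.subset_closure ⟨i, rfl⟩

/-- A simple reflection as an element of the Weyl group. -/
def reflection {n : ℕ} (i : Fin n) : weylGroup n := ⟨simpleRefl i, simpleRefl_mem i⟩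

theorem weylGroup_induction {n : ℕ} {p : weylGroup n → Prop} (one : p 1)
    (mul : ∀ i σ, p σ → p (reflection i * σ)) (σ : weylGroup n) : p σ := by
  obtain ⟨σ, hσ⟩ := σ
  unfold weylGroup at hσ
  induction hσ using Subgroup.closure_induction_left with
  | one => exact one
  | mul_left x hx y hy ih =>
    obtain ⟨i, rfl⟩ := hx
    exact mul i ⟨y, hy⟩ ih
  | inv_mul_cancel x hx y hy ih =>
    obtain ⟨i, rfl⟩ := hx
    have h : (simpleRefl i)⁻¹ = simpleRefl i := inv_eq_of_mul_eq_one_left (simpleRefl_mul_self i)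
    convert mul i ⟨y, hy⟩ ih using 1
    exact Subtype.ext (by simp [reflection, h])

theorem weylGroup_swap {n : ℕ} (σ : weylGroup n) (x : Letter n) :
    (σ : Equiv.Perm (Letter n)) x.swap = ((σ : Equiv.Perm (Letter n)) x).swap := by
  induction σ using weylGroup_induction generalizing x with
  | one => rfl
  | mul i σ ih => simp [reflection, ih, simpleRefl_swap]

theorem oddExt_act {n : ℕ} (σ : weylGroup n) (β : Weight n) (x : Letter n) :
    oddExt (act σ β) x = oddExt β ((σ : Equiv.Perm (Letter n)) x) := by
  cases x with
  | inl i => rw [← act_apply]; rfl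
  | inr i =>
    have h := weylGroup_swap σ (Sum.inl i)
    rw [Sum.swap_inl] at h
    rw [h, oddExt_swap, ← act_apply]; rfl

/-- `act σ` precomposes the odd extension with `σ`, so this is a right action; hence the reversed
product in `actMatrix_mul`. -/
theorem act_mul {n : ℕ} (σ τ : weylGroup n) (β : Weight n) :
    act (σ * τ) β = act τ (act σ β) := by
  ext i
  rw [act_apply, act_apply, oddExt_act]; rfl

theorem act_one {n : ℕ} (β : Weight n) : act 1 β = β := by
  ext i
  rw [act_apply]; rfl

theorem act_add {n : ℕ} (σ : weylGroup n) (β γ : Weight n) :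
    act σ (β + γ) = act σ β + act σ γ := by
  ext i
  simp only [Pi.add_apply, act_apply]
  cases (σ : Equiv.Perm (Letter n)) (Sum.inl i) <;> simp [oddExt]; ring

theorem act_injective {n : ℕ} (σ : weylGroup n) : Function.Injective (act (n := n) σ) := by
  intro β γ h
  have := congrArg (act σ⁻¹) h
  rwa [← act_mul, ← act_mul, mul_inv_cancel, act_one, act_one] at this

theorem act_reflection_zero {n : ℕ} (i : Fin n) (hi : (i : ℕ) = 0) (β : Weight n) (j : Fin n) :
    act (reflection i) β j = if j = i then -β i else β j := by
  rw [act_apply]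
  simp only [reflection, simpleRefl_zero_inl i hi]
  split_ifs <;> simp [oddExt]

theorem act_reflection_pos {n : ℕ} (i : Fin n) (hi : (i : ℕ) ≠ 0) (β : Weight n) (j : Fin n) :
    act (reflection i) β j = β (Equiv.swap (predIdx i) i j) := by
  rw [act_apply]
  simp [reflection, simpleRefl_pos_inl i hi, oddExt]

/-! ### The sign character -/

/-- The matrix of the action of `σ` on the weight lattice. -/
def actMatrix {n : ℕ} (σ : weylGroup n) : Matrix (Fin n) (Fin n) ℤ :=
  Matrix.of fun i j => act σ (Pi.single j 1) i

theorem act_sum {n : ℕ} {ι : Type*} (σ : weylGroup n) (s : Finset ι) (f : ι → Weight n) :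
    act σ (∑ i ∈ s, f i) = ∑ i ∈ s, act σ (f i) :=
  map_sum (AddMonoidHom.mk' (act σ) (act_add σ)) f s

theorem act_zsmul {n : ℕ} (σ : weylGroup n) (c : ℤ) (β : Weight n) :
    act σ (c • β) = c • act σ β :=
  map_zsmul (AddMonoidHom.mk' (act σ) (act_add σ)) c β

theorem act_eq_mulVec {n : ℕ} (σ : weylGroup n) (β : Weight n) :
    act σ β = (actMatrix σ).mulVec β := by
  have h : β = ∑ j, β j • (Pi.single j 1 : Weight n) := by
    ext i
    simp [Finset.sum_apply, Pi.single_apply]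
  conv_lhs => rw [h, act_sum]
  ext i
  simp only [act_zsmul]
  simp [Matrix.mulVec, dotProduct, actMatrix, mul_comm]

theorem actMatrix_mul {n : ℕ} (σ τ : weylGroup n) :
    actMatrix (σ * τ) = actMatrix τ * actMatrix σ := by
  apply Matrix.ext_of_mulVec_single
  intro j
  rw [← act_eq_mulVec, act_mul, ← Matrix.mulVec_mulVec, ← act_eq_mulVec, ← act_eq_mulVec]

theorem det_actMatrix_one {n : ℕ} : (actMatrix (1 : weylGroup n)).det = 1 := by
  have : actMatrix (1 : weylGroup n) = 1 := by
    apply Matrix.ext_of_mulVec_single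
    intro j
    rw [← act_eq_mulVec, act_one, Matrix.one_mulVec]
  rw [this, Matrix.det_one]

theorem det_actMatrix_reflection {n : ℕ} (i : Fin n) : (actMatrix (reflection i)).det = -1 := by
  by_cases hi : (i : ℕ) = 0
  · have : actMatrix (reflection i) = Matrix.diagonal (fun j => if j = i then (-1 : ℤ) else 1) := by
      ext j k
      rw [actMatrix, Matrix.of_apply, act_reflection_zero i hi, Matrix.diagonal_apply]
      by_cases h : j = i
      · subst h; by_cases h' : j = k <;> simp [h']
      · simp [h, Pi.single_apply]
    rw [this, Matrix.det_diagonal]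
    simp
  · have : actMatrix (reflection i) =
        (1 : Matrix (Fin n) (Fin n) ℤ).submatrix (Equiv.swap (predIdx i) i) id := by
      ext j k
      rw [actMatrix, Matrix.of_apply, act_reflection_pos i hi]
      simp [Pi.single_apply, Matrix.one_apply]
    rw [this, Matrix.det_permute, Equiv.Perm.sign_swap (predIdx_ne hi)]
    simp

theorem exists_list_prod {n : ℕ} (σ : weylGroup n) :
    ∃ L : List (Fin n), (L.map simpleRefl).prod = (σ : Equiv.Perm (Letter n)) := by
  induction σ using weylGroup_induction with
  | one => exact ⟨[], rfl⟩
  | mul i σ ih =>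
    obtain ⟨L, hL⟩ := ih
    exact ⟨i :: L, by simp [hL, reflection]⟩

theorem det_actMatrix_of_list {n : ℕ} (L : List (Fin n)) (σ : weylGroup n)
    (h : (L.map simpleRefl).prod = (σ : Equiv.Perm (Letter n))) :
    (actMatrix σ).det = (-1) ^ L.length := by
  induction L generalizing σ with
  | nil =>
    have : σ = 1 := Subtype.ext (by simpa using h.symm)
    rw [this, det_actMatrix_one]; rfl
  | cons i L ih =>
    have h1 : (L.map simpleRefl).prod =
        ((reflection i * σ : weylGroup n) : Equiv.Perm (Letter n)) := by
      rw [Subgroup.coe_mul, ← h, List.map_cons, List.prod_cons, ← mul_assoc]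
      simp [reflection, simpleRefl_mul_self]
    have h2 := ih _ h1
    rw [actMatrix_mul, Matrix.det_mul, det_actMatrix_reflection] at h2
    rw [List.length_cons, pow_succ]
    linarith

/-- Each generator has determinant `-1`, so every expression of `σ`, in particular a shortest one,
has length of the parity given by the determinant. The sign is thereby multiplicative without any
study of reduced words. -/
theorem sgn_eq_det {n : ℕ} (σ : weylGroup n) : sgn σ = (actMatrix σ).det := by
  obtain ⟨L, hL⟩ := exists_list_prod σ
  have hne : {k | ∃ L : List (Fin n), L.length = k ∧
      (L.map simpleRefl).prod = (σ : Equiv.Perm (Letter n))}.Nonempty := ⟨_, L, rfl, hL⟩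
  obtain ⟨L', h1, h2⟩ := Nat.sInf_mem hne
  rw [det_actMatrix_of_list L' σ h2, h1]; rfl

theorem sgn_mul {n : ℕ} (σ τ : weylGroup n) : sgn (σ * τ) = sgn σ * sgn τ := by
  rw [sgn_eq_det, sgn_eq_det, sgn_eq_det, actMatrix_mul, Matrix.det_mul, mul_comm]

theorem sgn_one {n : ℕ} : sgn (1 : weylGroup n) = 1 := by
  rw [sgn_eq_det, det_actMatrix_one]

theorem sgn_reflection {n : ℕ} (i : Fin n) : sgn (reflection i) = -1 := by
  rw [sgn_eq_det, det_actMatrix_reflection]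

/-! ### Antisymmetric functions -/

/-- A function on weights is antisymmetric if simple reflections change its sign and it vanishes
on their hyperplanes. -/
structure Antisymm {n : ℕ} {A : Type*} [AddCommGroup A] (g : Weight n → A) : Prop where
  map_reflection : ∀ i x, g (act (reflection i) x) = -g x
  eq_zero : ∀ i x, act (reflection i) x = x → g x = 0

theorem Antisymm.map_act {n : ℕ} {A : Type*} [AddCommGroup A] {g : Weight n → A}
    (hg : Antisymm g) (σ : weylGroup n) (x : Weight n) : g (act σ x) = sgn σ • g x := by
  induction σ using weylGroup_induction generalizing x with
  | one => simp [act_one, sgn_one]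
  | mul i σ ih => rw [act_mul, ih, hg.map_reflection, sgn_mul, sgn_reflection]; simp

theorem antisymm_sum_act {n : ℕ} {A : Type*} [AddCommGroup A] [IsAddTorsionFree A]
    (P : Weight n → A) : Antisymm (fun x => ∑ σ : weylGroup n, sgn σ • P (act σ x)) := by
  have key : ∀ i x, ∑ σ : weylGroup n, sgn σ • P (act σ (act (reflection i) x)) =
      -∑ σ : weylGroup n, sgn σ • P (act σ x) := by
    intro i x
    rw [← Finset.sum_neg_distrib]
    refine Fintype.sum_equiv (Equiv.mulLeft (reflection i)) _ _ fun σ => ?_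
    simp [act_mul, sgn_mul, sgn_reflection]
  refine ⟨key, fun i x h => ?_⟩
  have := key i x
  rw [h] at this
  -- Torsion-freeness is what turns `y = -y` into `y = 0` on a wall.
  exact self_eq_neg.mp this

/-! ### Chambers -/

/-- Take the orbit point with the largest pairing with `ρ`: reflecting a descent, or a negative
entry at index `0`, would increase the pairing. -/
theorem exists_act_monotone {n : ℕ} (x : Weight n) :
    ∃ σ : weylGroup n, Monotone (act σ x) ∧ ∀ i, 0 ≤ act σ x i := by
  obtain ⟨σ, hσ⟩ := Finite.exists_max (fun σ : weylGroup n => ∑ j : Fin n, ((j : ℤ) + 1) * act σ x j)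
  have h0 : ∀ i : Fin n, (i : ℕ) = 0 → 0 ≤ act σ x i := by
    intro i hi
    have h := hσ (σ * reflection i)
    simp only [act_mul, act_reflection_zero i hi] at h
    rw [← Finset.add_sum_erase _ _ (Finset.mem_univ i),
      ← Finset.add_sum_erase _ (fun j : Fin n => ((j : ℤ) + 1) * act σ x j) (Finset.mem_univ i),
      Finset.sum_congr rfl (g := fun j : Fin n => ((j : ℤ) + 1) * act σ x j)] at h
    · simp [hi] at h; linarith
    · intro j hj
      simp [Finset.ne_of_mem_erase hj]
  have h1 : ∀ i : Fin n, (i : ℕ) ≠ 0 → act σ x (predIdx i) ≤ act σ x i := by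
    intro i hi
    have h := hσ (σ * reflection i)
    simp only [act_mul, act_reflection_pos i hi] at h
    rw [← Equiv.sum_comp (Equiv.swap (predIdx i) i)] at h
    simp only [Equiv.swap_apply_self] at h
    rw [← sub_nonneg, ← Finset.sum_sub_distrib,
      Finset.sum_eq_add_of_mem (predIdx i) i (Finset.mem_univ _) (Finset.mem_univ _)
        (predIdx_ne hi)] at h
    · rw [Equiv.swap_apply_left, Equiv.swap_apply_right] at h
      have : ((predIdx i : Fin n) : ℤ) = i - 1 := by simp only [predIdx]; omega
      rw [this] at h
      linarith
    · intro j _ hj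
      rw [Equiv.swap_apply_of_ne_of_ne hj.1 hj.2]; ring
  refine ⟨σ, ?_⟩
  cases n with
  | zero => exact ⟨fun i => i.elim0, fun i => i.elim0⟩
  | succ n =>
    have hm : Monotone (act σ x) := by
      rw [Fin.monotone_iff_le_succ]
      intro i
      have := h1 i.succ (by simp)
      exact this
    exact ⟨hm, fun i => (h0 0 rfl).trans (hm (Fin.zero_le i))⟩

/-- Positivity of both weights makes `σ` send barred letters to barred letters; strict monotonicity
makes the induced map of indices increasing, hence the identity. -/
theorem eq_one_of_act {n : ℕ} {σ : weylGroup n} {x : Weight n} (hx : StrictMono x)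
    (hx0 : ∀ i, 0 < x i) (hy : StrictMono (act σ x)) (hy0 : ∀ i, 0 < act σ x i) : σ = 1 := by
  have h : ∀ i, ∃ j, (σ : Equiv.Perm (Letter n)) (Sum.inl i) = Sum.inl j := by
    intro i
    have h1 := hy0 i
    rw [act_apply] at h1
    cases h2 : (σ : Equiv.Perm (Letter n)) (Sum.inl i) with
    | inl j => exact ⟨j, rfl⟩
    | inr j =>
      have := hx0 j
      simp only [h2, oddExt, Sum.elim_inr] at h1
      omega
  choose f hf using h
  have hfm : StrictMono f := by
    intro i j hij
    have := hy hij
    simp only [act_apply, hf, oddExt, Sum.elim_inl] at this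
    exact hx.lt_iff_lt.mp this
  have hfid : f = id := hfm.eq_id
  ext y : 2
  have hl : ∀ i, (σ : Equiv.Perm (Letter n)) (Sum.inl i) = Sum.inl i := by
    intro i; rw [hf, hfid]; rfl
  cases y with
  | inl i => simp [hl]
  | inr i =>
    have := weylGroup_swap σ (Sum.inl i)
    rw [Sum.swap_inl, hl] at this
    simpa using this

theorem IsDominant.strictMono_add_rho {n : ℕ} {γ : Weight n} (h : IsDominant γ) :
    StrictMono (γ + rho n) ∧ ∀ i, 0 < (γ + rho n) i := by
  refine ⟨h.1.add_strictMono ?_, fun i => ?_⟩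
  · intro i j hij
    simp only [rho]
    have : (i : ℕ) < j := hij
    omega
  · have := h.2 i
    simp only [Pi.add_apply, rho]
    omega

theorem isDominant_sub_rho {n : ℕ} {x : Weight n} (hx : StrictMono x) (hx0 : ∀ i, 0 < x i) :
    IsDominant (x - rho n) := by
  cases n with
  | zero => exact ⟨fun i => i.elim0, fun i => i.elim0⟩
  | succ n =>
    have hm : Monotone (x - rho (n + 1)) := by
      rw [Fin.monotone_iff_le_succ]
      intro i
      have : x i.castSucc < x i.succ := hx (Fin.castSucc_lt_succ)
      simp only [Pi.sub_apply, rho, Fin.val_castSucc, Fin.val_succ]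
      push_cast
      omega
    refine ⟨hm, fun i => le_trans ?_ (hm (Fin.zero_le i))⟩
    have := hx0 0
    simp only [Pi.sub_apply, rho, Fin.val_zero]
    omega

/-- The map from pairs (dominant weight, Weyl group element) to weights, for the dot action. -/
def dotMap {n : ℕ} (p : DominantWeight n × weylGroup n) : Weight n :=
  act p.2 (p.1.1 + rho n) - rho n

theorem dotMap_injective {n : ℕ} : Function.Injective (dotMap (n := n)) := by
  rintro ⟨⟨γ, hγ⟩, σ⟩ ⟨⟨γ', hγ'⟩, σ'⟩ h
  simp only [dotMap, sub_left_inj] at h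
  obtain ⟨h1, h2⟩ := hγ.strictMono_add_rho
  obtain ⟨h1', h2'⟩ := hγ'.strictMono_add_rho
  have h3 : act (σ * σ'⁻¹) (γ + rho n) = γ' + rho n := by
    rw [act_mul, h, ← act_mul, mul_inv_cancel, act_one]
  have h4 : σ * σ'⁻¹ = 1 := eq_one_of_act h1 h2 (h3 ▸ h1') (h3 ▸ h2')
  rw [h4, act_one] at h3
  have h5 : σ = σ' := mul_inv_eq_one.mp h4
  have h6 : γ = γ' := add_right_cancel h3
  subst h5 h6
  rfl

/-- The chamber representative of `β + ρ` cannot be fixed by a simple reflection, since `g` would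
vanish there. So it is strictly increasing and positive, and subtracting `ρ` leaves a dominant
weight. -/
theorem mem_range_dotMap {n : ℕ} {A : Type*} [AddCommGroup A] {g : Weight n → A}
    (hg : Antisymm g) {β : Weight n} (h : g (β + rho n) ≠ 0) : β ∈ Set.range (dotMap (n := n)) := by
  obtain ⟨σ, hm, h0⟩ := exists_act_monotone (β + rho n)
  have hne : ∀ i, act (reflection i) (act σ (β + rho n)) ≠ act σ (β + rho n) := by
    intro i hi
    have := hg.eq_zero i _ hi
    rw [hg.map_act] at this
    have hs : sgn σ = 1 ∨ sgn σ = -1 := neg_one_pow_eq_or _ _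
    rcases hs with hs | hs <;> simp [hs] at this <;> exact h this
  have hstrict : StrictMono (act σ (β + rho n)) ∧ ∀ i, 0 < act σ (β + rho n) i := by
    generalize act σ (β + rho n) = y at *
    cases n with
    | zero => exact ⟨fun i => i.elim0, fun i => i.elim0⟩
    | succ n =>
      have hs : StrictMono y := by
        rw [Fin.strictMono_iff_lt_succ]
        intro i
        refine lt_of_le_of_ne (hm (Fin.castSucc_le_succ i)) fun heq => hne i.succ ?_
        have hp : predIdx i.succ = i.castSucc := rfl
        ext j
        rw [act_reflection_pos _ (by simp), hp, Equiv.swap_apply_def]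
        split_ifs with h1 h2
        · rw [h1, heq]
        · rw [h2, heq]
        · rfl
      refine ⟨hs, fun i => lt_of_lt_of_le ?_ (hm (Fin.zero_le i))⟩
      refine lt_of_le_of_ne (h0 0) fun heq => hne 0 ?_
      ext j
      rw [act_reflection_zero _ rfl]
      split_ifs with h1
      · rw [h1]; omega
      · rfl
  refine ⟨⟨⟨_, isDominant_sub_rho hstrict.1 hstrict.2⟩, σ⁻¹⟩, ?_⟩
  simp only [dotMap, sub_add_cancel]
  rw [← act_mul, mul_inv_cancel, act_one, add_sub_cancel_right]

/-- Each weight that can contribute is `σ(γ + ρ) - ρ` for exactly one pair `(γ, σ)`. The function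
`g` only certifies which weights may be ignored. -/
theorem finsum_eq_finsum_dominant {n : ℕ} {A B : Type*} [AddCommGroup A] [AddCommMonoid B]
    {g : Weight n → A} (hg : Antisymm g) (h : Weight n → B) (hfin : (Function.support h).Finite)
    (hgh : ∀ β, g (β + rho n) = 0 → h β = 0) :
    ∑ᶠ β, h β = ∑ᶠ γ : DominantWeight n, ∑ σ : weylGroup n, h (dotMap (γ, σ)) := by
  have h1 : ∑ᶠ p : DominantWeight n × weylGroup n, h (dotMap p) = ∑ᶠ β, h β := by
    rw [← finsum_mem_univ h, ← finsum_mem_range dotMap_injective]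
    refine finsum_mem_inter_support_eq _ _ _ ?_
    ext β
    simp only [Set.mem_inter_iff, Set.mem_univ, true_and, Function.mem_support, and_iff_right_iff_imp]
    exact fun hβ => mem_range_dotMap hg fun h0 => hβ (hgh β h0)
  rw [← h1, finsum_curry]
  · simp only [finsum_eq_sum_of_fintype]
  · exact hfin.preimage dotMap_injective.injOn

/-! ### The Pieri rule by sign-reversing involutions -/

/-- The weight of a multiset of letters. -/
def countWeight {n : ℕ} (k : Letter n → ℕ) : Weight n := fun j => k (Sum.inl j) - k (Sum.inr j)

/-- Each bad `k` is filed under its failing index of least rank, and every such class sums to zero.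
The rank allows scanning the indices in either direction. -/
theorem sum_eq_sum_of_forall_not {ι α A : Type*} [Fintype ι] [AddCommMonoid A]
    (S T : Finset α) (f : α → A) (P : ι → α → Prop) (rk : ι → ℤ) (hrk : Function.Injective rk)
    (hT : ∀ k, k ∈ T ↔ k ∈ S ∧ ∀ i, ¬ P i k)
    (h : ∀ i (U : Finset α), (∀ k, k ∈ U ↔ k ∈ S ∧ P i k ∧ ∀ j, rk j < rk i → ¬ P j k) →
      ∑ k ∈ U, f k = 0) :
    ∑ k ∈ S, f k = ∑ k ∈ T, f k := by
  classical
  have hU : S.filter (fun k => ∃ i, P i k) =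
      Finset.univ.biUnion fun i => S.filter fun k => P i k ∧ ∀ j, rk j < rk i → ¬ P j k := by
    ext k
    simp only [Finset.mem_filter, Finset.mem_biUnion, Finset.mem_univ, true_and]
    constructor
    · rintro ⟨hk, hex⟩
      obtain ⟨i, hi, hmin⟩ := Finset.exists_min_image (Finset.univ.filter fun i => P i k) rk
        (by obtain ⟨i, hi⟩ := hex; exact ⟨i, by simpa using hi⟩)
      refine ⟨i, hk, by simpa using hi, fun j hj hPj => ?_⟩
      exact absurd (hmin j (by simpa using hPj)) (not_le.mpr hj)
    · rintro ⟨i, hk, hi, -⟩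
      exact ⟨hk, i, hi⟩
  have hTS : T = S.filter (fun k => ¬ ∃ i, P i k) := by
    ext k
    rw [hT, Finset.mem_filter, not_exists]
  rw [hTS, ← Finset.sum_filter_add_sum_filter_not S (fun k => ∃ i, P i k), hU, Finset.sum_biUnion,
    Finset.sum_eq_zero fun i _ => h i _ fun k => Finset.mem_filter, zero_add]
  intro i _ j _ hij
  rw [Function.onFun, Finset.disjoint_left]
  intro k hk hk'
  simp only [Finset.mem_filter] at hk hk'
  rcases lt_trichotomy (rk i) (rk j) with hlt | heq | hlt
  · exact hk'.2.2 i hlt hk.2.1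
  · exact hij (hrk heq)
  · exact hk.2.2 j hlt hk'.2.1

/-- `φ` lifts `s_i` to multisets: paired terms have opposite signs, and a fixed multiset has its
shifted weight on the wall, where `g` vanishes. -/
theorem sum_eq_zero_of_reflection {n : ℕ} {A : Type*} [AddCommGroup A] {g : Weight n → A}
    (hg : Antisymm g) (γ : Weight n) (i : Fin n) (S : Finset (Letter n → ℕ))
    (φ : (Letter n → ℕ) → (Letter n → ℕ)) (hmem : ∀ k ∈ S, φ k ∈ S)
    (hinv : ∀ k ∈ S, φ (φ k) = k)
    (hwt : ∀ k ∈ S, γ + countWeight (φ k) + rho n =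
      act (reflection i) (γ + countWeight k + rho n)) :
    ∑ k ∈ S, g (γ + countWeight k + rho n) = 0 := by
  refine Finset.sum_involution (fun k _ => φ k) (fun k hk => ?_) (fun k hk h0 heq => h0 ?_)
    hmem hinv
  · rw [hwt k hk, hg.map_reflection, add_neg_cancel]
  · refine hg.eq_zero i _ ?_
    rw [← hwt k hk, heq]

/-- Change the multiplicities of the letters with index `i` or `p`. -/
def modifyAt {n : ℕ} (i p : Fin n) (a a' b b' : ℕ) (k : Letter n → ℕ) : Letter n → ℕ :=
  Sum.elim (fun j => if j = i then a else if j = p then a' else k (Sum.inl j))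
    (fun j => if j = i then b else if j = p then b' else k (Sum.inr j))

theorem sum_modify {n : ℕ} {i p : Fin n} (h : p ≠ i) (a a' : ℕ) (f : Fin n → ℕ) :
    ∑ j, (if j = i then a else if j = p then a' else f j) + f i + f p = ∑ j, f j + a + a' := by
  have hp : p ∈ Finset.univ.erase i := by simp [h]
  rw [← Finset.add_sum_erase _ _ (Finset.mem_univ i), ← Finset.add_sum_erase _ f (Finset.mem_univ i),
    ← Finset.add_sum_erase _ _ hp, ← Finset.add_sum_erase _ f hp,
    Finset.sum_congr rfl (g := f)]
  · simp [h]; ring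
  · intro j hj
    simp only [Finset.mem_erase] at hj
    simp [hj.1, hj.2.1]

theorem sum_modifyAt {n : ℕ} {i p : Fin n} (h : p ≠ i) {a a' b b' : ℕ} {k : Letter n → ℕ}
    (hs : a + a' + b + b' = k (.inl i) + k (.inl p) + k (.inr i) + k (.inr p)) :
    ∑ x, modifyAt i p a a' b b' k x = ∑ x, k x := by
  have h1 := sum_modify h a a' (fun j => k (.inl j))
  have h2 := sum_modify h b b' (fun j => k (.inr j))
  simp only [Fintype.sum_sum_type, modifyAt, Sum.elim_inl, Sum.elim_inr]
  omega

theorem sum_modify_one {n : ℕ} (i : Fin n) (a : ℕ) (f : Fin n → ℕ) :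
    ∑ j, (if j = i then a else f j) + f i = ∑ j, f j + a := by
  rw [← Finset.add_sum_erase _ _ (Finset.mem_univ i), ← Finset.add_sum_erase _ f (Finset.mem_univ i),
    Finset.sum_congr rfl (g := f)]
  · simp; ring
  · intro j hj
    simp [Finset.ne_of_mem_erase hj]

theorem sum_modifyAt_self {n : ℕ} {i : Fin n} {a b : ℕ} {k : Letter n → ℕ}
    (hs : a + b = k (.inl i) + k (.inr i)) :
    ∑ x, modifyAt i i a a b b k x = ∑ x, k x := by
  have h1 := sum_modify_one i a (fun j => k (.inl j))
  have h2 := sum_modify_one i b (fun j => k (.inr j))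
  have h3 : ∀ (c : ℕ) (f : Fin n → ℕ) (j : Fin n),
      (if j = i then c else if j = i then c else f j) = if j = i then c else f j := by
    intro c f j; split_ifs <;> rfl
  simp only [Fintype.sum_sum_type, modifyAt, Sum.elim_inl, Sum.elim_inr, h3 _ (fun j => k (.inl j)),
    h3 _ (fun j => k (.inr j))]
  omega

/-- Removing the unbarred letters `i + 1` from `γ` leaves the dominant chamber. -/
def RemovalFails {n : ℕ} (γ : Weight n) (i : Fin n) (k : Letter n → ℕ) : Prop :=
  γ i - k (.inr i) < if (i : ℕ) = 0 then 0 else γ (predIdx i)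

/-- After the removals, adding the barred letters before `i + 1` leaves the dominant chamber. -/
def AdditionFails {n : ℕ} (γ : Weight n) (i : Fin n) (k : Letter n → ℕ) : Prop :=
  (i : ℕ) ≠ 0 ∧
    γ i - k (.inr i) < γ (predIdx i) - k (.inr (predIdx i)) + k (.inl (predIdx i))

/-- The two hypotheses exchange the entries at `i` and `predIdx i`; the `1` is the difference of the
entries of `ρ` there. -/
theorem add_countWeight_eq_reflection_pos {n : ℕ} {γ : Weight n} {i : Fin n} (hi : (i : ℕ) ≠ 0)
    {k : Letter n → ℕ} {a a' b b' : ℕ}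
    (h1 : γ i + a - b + 1 = γ (predIdx i) + k (.inl (predIdx i)) - k (.inr (predIdx i)))
    (h2 : γ (predIdx i) + a' - b' = γ i + k (.inl i) - k (.inr i) + 1) :
    γ + countWeight (modifyAt i (predIdx i) a a' b b' k) + rho n =
      act (reflection i) (γ + countWeight k + rho n) := by
  have hp := predIdx_ne hi
  have hv : ((predIdx i : Fin n) : ℤ) = i - 1 := by simp only [predIdx]; omega
  ext j
  rw [act_reflection_pos i hi]
  simp only [Pi.add_apply, countWeight, modifyAt, rho, Sum.elim_inl, Sum.elim_inr]
  by_cases hj : j = i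
  · subst hj
    rw [Equiv.swap_apply_right, hv, if_pos rfl, if_pos rfl]
    linarith
  · by_cases hj' : j = predIdx i
    · subst hj'
      rw [Equiv.swap_apply_left, hv, if_neg hj, if_neg hj, if_pos rfl, if_pos rfl]
      linarith
    · rw [Equiv.swap_apply_of_ne_of_ne hj' hj]
      simp [hj, hj']

/-- The `2` is twice the entry of `ρ` at index `0`. -/
theorem add_countWeight_eq_reflection_zero {n : ℕ} {γ : Weight n} {i : Fin n} (hi : (i : ℕ) = 0)
    {k : Letter n → ℕ} {a b : ℕ}
    (h : γ i + a - b + 2 = -(γ i + k (.inl i) - k (.inr i))) :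
    γ + countWeight (modifyAt i i a a b b k) + rho n =
      act (reflection i) (γ + countWeight k + rho n) := by
  ext j
  rw [act_reflection_zero i hi]
  simp only [Pi.add_apply, countWeight, modifyAt, rho, Sum.elim_inl, Sum.elim_inr]
  by_cases hj : j = i
  · subst hj
    simp only [if_true, hi]
    push_cast
    linarith
  · simp [hj]

-- Cancellation of the multisets that violate a Pieri inequality.

section

variable {n : ℕ} {A : Type*} [AddCommGroup A] {g : Weight n → A}

theorem sum_removalFails_zero (hg : Antisymm g) {γ : Weight n} (hγ : IsDominant γ) (r : ℕ)
    (i : Fin n) (hi : (i : ℕ) = 0) (T : Finset (Letter n → ℕ))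
    (hT : ∀ k, k ∈ T ↔ k ∈ Finset.piAntidiag Finset.univ r ∧
      RemovalFails γ i k ∧ ∀ j : Fin n, -(j : ℤ) < -(i : ℤ) → ¬ RemovalFails γ j k) :
    ∑ k ∈ T, g (γ + countWeight k + rho n) = 0 := by
  have h0 := hγ.2 i
  -- Negating the shifted entry and keeping the total count determines the two new counts. Failure
  -- of the removal makes the first one nonnegative, so `toNat` loses nothing; the second exceeds `γ
  -- i`, so the removal still fails.
  refine sum_eq_zero_of_reflection hg γ i _ (fun k => modifyAt i i
    (k (.inr i) - γ i - 1).toNat (k (.inr i) - γ i - 1).toNat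
    (γ i + 1 + k (.inl i)).toNat (γ i + 1 + k (.inl i)).toNat k) ?_ ?_ ?_
  · intro k hk
    simp only [hT, Finset.mem_piAntidiag, RemovalFails, hi, if_true] at hk ⊢
    obtain ⟨⟨hr, -⟩, hf, hj⟩ := hk
    refine ⟨⟨?_, by simp⟩, ?_, fun j hji => ?_⟩
    · rw [← hr]
      exact sum_modifyAt_self (by omega)
    · simp only [modifyAt, Sum.elim_inr, if_true]
      omega
    · have := hj j hji
      have hne : j ≠ i := by rintro rfl; omega
      simpa [modifyAt, hne] using this
  · intro k hk
    simp only [hT, RemovalFails, hi, if_true] at hk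
    ext x
    rcases x with j | j
    · by_cases h : j = i
      · subst h; simp [modifyAt]; omega
      · simp [modifyAt, h]
    · by_cases h : j = i
      · subst h; simp [modifyAt]; omega
      · simp [modifyAt, h]
  · intro k hk
    simp only [hT, RemovalFails, hi, if_true] at hk
    exact add_countWeight_eq_reflection_zero hi (by omega)

/-- The removal condition at `j` reads only the count of `inr j`, and only the indices `i` and
`predIdx i` are altered. Thus the largest failing index stays the largest. -/
theorem sum_removalFails_pos (hg : Antisymm g) {γ : Weight n} (hγ : IsDominant γ) (r : ℕ)
    (i : Fin n) (hi : (i : ℕ) ≠ 0) (T : Finset (Letter n → ℕ))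
    (hT : ∀ k, k ∈ T ↔ k ∈ Finset.piAntidiag Finset.univ r ∧
      RemovalFails γ i k ∧ ∀ j : Fin n, -(j : ℤ) < -(i : ℤ) → ¬ RemovalFails γ j k) :
    ∑ k ∈ T, g (γ + countWeight k + rho n) = 0 := by
  have hp := predIdx_ne hi
  have hv : ((predIdx i : Fin n) : ℕ) = i - 1 := rfl
  have h0 : γ (predIdx i) ≤ γ i := hγ.1 (by rw [Fin.le_def, hv]; omega)
  refine sum_eq_zero_of_reflection hg γ i _ (fun k => modifyAt i (predIdx i)
    (k (.inl (predIdx i))) (k (.inl i))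
    (γ i + 1 - γ (predIdx i) + k (.inr (predIdx i))).toNat
    (γ (predIdx i) - γ i - 1 + k (.inr i)).toNat k) ?_ ?_ ?_
  · intro k hk
    simp only [hT, Finset.mem_piAntidiag, RemovalFails] at hk ⊢
    obtain ⟨⟨hr, -⟩, hf, hj⟩ := hk
    rw [if_neg hi] at hf ⊢
    refine ⟨⟨?_, by simp⟩, ?_, fun j hji => ?_⟩
    · rw [← hr]
      exact sum_modifyAt hp (by omega)
    · simp only [modifyAt, Sum.elim_inr, if_true]
      omega
    · have := hj j hji
      have hne : j ≠ i := by rintro rfl; omega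
      have hne' : j ≠ predIdx i := by rintro rfl; omega
      simpa [modifyAt, hne, hne'] using this
  · intro k hk
    simp only [hT, RemovalFails, if_neg hi] at hk
    ext x
    rcases x with j | j
    · by_cases h : j = i
      · subst h; simp [modifyAt, hp]
      · by_cases h' : j = predIdx i
        · subst h'; simp [modifyAt, hp]
        · simp [modifyAt, h, h']
    · by_cases h : j = i
      · subst h; simp [modifyAt, hp]; omega
      · by_cases h' : j = predIdx i
        · subst h'; simp [modifyAt, hp]; omega
        · simp [modifyAt, h, h']
  · intro k hk
    simp only [hT, RemovalFails, if_neg hi] at hk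
    exact add_countWeight_eq_reflection_pos hi (by omega) (by omega)

/-- Only barred counts move, so the removal conditions are untouched. The addition condition at `j`
reads the barred count at `predIdx j`, so conditions below `i` are unaffected and the smallest
failing index stays the smallest. -/
theorem sum_additionFails (hg : Antisymm g) {γ : Weight n} (r : ℕ) (i : Fin n)
    (T : Finset (Letter n → ℕ))
    (hT : ∀ k, k ∈ T ↔ (k ∈ Finset.piAntidiag Finset.univ r ∧ ∀ j, ¬ RemovalFails γ j k) ∧
      AdditionFails γ i k ∧ ∀ j : Fin n, (j : ℤ) < (i : ℤ) → ¬ AdditionFails γ j k) :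
    ∑ k ∈ T, g (γ + countWeight k + rho n) = 0 := by
  by_cases hi : (i : ℕ) = 0
  · rw [Finset.eq_empty_of_forall_notMem fun k hk => ((hT k).mp hk).2.1.1 hi, Finset.sum_empty]
  have hp := predIdx_ne hi
  have hv : ((predIdx i : Fin n) : ℕ) = i - 1 := rfl
  refine sum_eq_zero_of_reflection hg γ i _ (fun k => modifyAt i (predIdx i)
    (γ (predIdx i) - k (.inr (predIdx i)) + k (.inl (predIdx i)) - 1 - (γ i - k (.inr i))).toNat
    (γ i - k (.inr i) + k (.inl i) + 1 - (γ (predIdx i) - k (.inr (predIdx i)))).toNat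
    (k (.inr i)) (k (.inr (predIdx i))) k) ?_ ?_ ?_
  all_goals
    intro k hk
    simp only [hT, Finset.mem_piAntidiag, AdditionFails] at hk ⊢
    obtain ⟨⟨⟨hr, -⟩, hR⟩, ⟨-, hf⟩, hj⟩ := hk
    -- The removal at `i` succeeds, so `γ i - k (.inr i) ≥ γ (predIdx i)`; this keeps the second
    -- `toNat` argument positive.
    have hRi := hR i
    rw [RemovalFails, if_neg hi] at hRi
  · have hinr : ∀ j, modifyAt i (predIdx i)
        (γ (predIdx i) - k (.inr (predIdx i)) + k (.inl (predIdx i)) - 1 -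
          (γ i - k (.inr i))).toNat
        (γ i - k (.inr i) + k (.inl i) + 1 - (γ (predIdx i) - k (.inr (predIdx i)))).toNat
        (k (.inr i)) (k (.inr (predIdx i))) k (.inr j) = k (.inr j) := by
      intro j
      simp only [modifyAt, Sum.elim_inr]
      split_ifs with h1 h2
      · rw [h1]
      · rw [h2]
      · rfl
    refine ⟨⟨⟨?_, by simp⟩, fun j => ?_⟩, ⟨hi, ?_⟩, fun j hji hfj => ?_⟩
    · rw [← hr]
      exact sum_modifyAt hp (by omega)
    · rw [RemovalFails, hinr]
      exact hR j
    · rw [hinr, hinr]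
      simp only [modifyAt, Sum.elim_inl, if_neg hp, if_true]
      omega
    · refine hj j hji ⟨hfj.1, ?_⟩
      have h2 := hfj.2
      have hv' : ((predIdx j : Fin n) : ℕ) = j - 1 := rfl
      have hne : predIdx j ≠ i := by intro h; rw [← h] at hji; omega
      have hne' : predIdx j ≠ predIdx i := by
        intro h
        have := congrArg Fin.val h
        have := hfj.1
        omega
      rw [hinr, hinr] at h2
      simpa [modifyAt, hne, hne'] using h2
  · ext x
    rcases x with j | j
    · by_cases h : j = i
      · subst h; simp [modifyAt, hp]; omega
      · by_cases h' : j = predIdx i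
        · subst h'; simp [modifyAt, hp]; omega
        · simp [modifyAt, h, h']
    · by_cases h : j = i
      · subst h; simp [modifyAt]
      · by_cases h' : j = predIdx i
        · subst h'; simp [modifyAt, hp]
        · simp [modifyAt, h, h']
  · exact add_countWeight_eq_reflection_pos hi (by omega) (by omega)

/-- The multiset of letters corresponds to a highest weight vertex of `B(γ) ⊗ B((r))`. -/
def IsPieri {n : ℕ} (γ : Weight n) (k : Letter n → ℕ) : Prop :=
  ∀ i, ¬ RemovalFails γ i k ∧ ¬ AdditionFails γ i k

/-- Removal failures are cancelled first, by largest failing index; then addition failures by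
smallest failing index, whose involution needs all removals to succeed. -/
theorem sum_countWeight_eq_sum_isPieri (hg : Antisymm g) {γ : Weight n} (hγ : IsDominant γ)
    (r : ℕ) (T : Finset (Letter n → ℕ))
    (hT : ∀ k, k ∈ T ↔ k ∈ Finset.piAntidiag Finset.univ r ∧ IsPieri γ k) :
    ∑ k ∈ Finset.piAntidiag Finset.univ r, g (γ + countWeight k + rho n) =
      ∑ k ∈ T, g (γ + countWeight k + rho n) := by
  classical
  rw [sum_eq_sum_of_forall_not (Finset.piAntidiag Finset.univ r)
    ((Finset.piAntidiag Finset.univ r).filter fun k => ∀ j, ¬ RemovalFails γ j k)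
    (fun k => g (γ + countWeight k + rho n)) (RemovalFails γ) (fun j => -(j : ℤ))
    (fun a b h => Fin.ext (by simpa using h)) (fun k => Finset.mem_filter) (fun i U hU => by
      by_cases hi : (i : ℕ) = 0
      · exact sum_removalFails_zero hg hγ r i hi U hU
      · exact sum_removalFails_pos hg hγ r i hi U hU)]
  refine sum_eq_sum_of_forall_not _ _
    (fun k => g (γ + countWeight k + rho n)) (AdditionFails γ) (fun j => (j : ℤ))
    (fun a b h => Fin.ext (by simpa using h)) (fun k => ?_)
    (fun i U hU => sum_additionFails hg r i U fun k => by rw [hU, Finset.mem_filter])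
  rw [hT, Finset.mem_filter, and_assoc]
  simp only [IsPieri, forall_and]

end

/-! ### Seminormal crystals -/

/-- The operators `ẽ_i` and `f̃_i` are mutually inverse and `E`, `F` are their string lengths. -/
structure IsSeminormal {I B : Type} (C : CrystalOps I B) (E F : I → B → ℕ) : Prop where
  e_eq_none : ∀ i b, C.e i b = none ↔ E i b = 0
  f_eq_none : ∀ i b, C.f i b = none ↔ F i b = 0
  of_e : ∀ i b b', C.e i b = some b' → E i b = E i b' + 1 ∧ F i b' = F i b + 1
  e_iff_f : ∀ i b b', C.e i b = some b' ↔ C.f i b' = some b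

theorem iter_succ {B : Type} (g : B → Option B) (k : ℕ) (b : B) :
    CrystalOps.iter g (k + 1) b = (g b).bind (CrystalOps.iter g k) := by
  unfold CrystalOps.iter
  rw [Function.iterate_succ_apply, Option.bind_some]
  cases g b with
  | some b' => rfl
  | none =>
    rw [Option.bind_none]
    induction k with
    | zero => rfl
    | succ k ih => rw [Function.iterate_succ_apply, Option.bind_none, ih]

theorem iter_ne_none_iff {B : Type} {g : B → Option B} {E : B → ℕ}
    (h0 : ∀ b, g b = none ↔ E b = 0) (h1 : ∀ b b', g b = some b' → E b = E b' + 1) (k : ℕ) (b : B) :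
    CrystalOps.iter g k b ≠ none ↔ k ≤ E b := by
  induction k generalizing b with
  | zero => simp [CrystalOps.iter]
  | succ k ih =>
    rw [iter_succ]
    cases hb : g b with
    | none => simp [(h0 b).mp hb]
    | some b' =>
      rw [Option.bind_some, ih, h1 b b' hb]
      omega

theorem sSup_iter {B : Type} {g : B → Option B} {E : B → ℕ}
    (h0 : ∀ b, g b = none ↔ E b = 0) (h1 : ∀ b b', g b = some b' → E b = E b' + 1) (b : B) :
    sSup {k | CrystalOps.iter g k b ≠ none} = E b := by
  have : {k | CrystalOps.iter g k b ≠ none} = Set.Iic (E b) := by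
    ext k
    exact iter_ne_none_iff h0 h1 k b
  rw [this, csSup_Iic]

namespace IsSeminormal

variable {I B B' : Type} {C : CrystalOps I B} {C' : CrystalOps I B'} {E F : I → B → ℕ}
  {E' F' : I → B' → ℕ}

theorem eps_eq (h : IsSeminormal C E F) (i : I) (b : B) : C.eps i b = E i b :=
  sSup_iter (h.e_eq_none i) (fun b b' hb => (h.of_e i b b' hb).1) b

theorem phi_eq (h : IsSeminormal C E F) (i : I) (b : B) : C.phi i b = F i b :=
  sSup_iter (h.f_eq_none i) (fun b b' hb => (h.of_e i b' b ((h.e_iff_f i b' b).mpr hb)).2) b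

/-- The truncated subtractions are the signature rule: `φ`'s of the left factor cancel `ε`'s of the
right one. -/
theorem tensor (h : IsSeminormal C E F) (h' : IsSeminormal C' E' F') :
    IsSeminormal (C.tensor C') (fun i p => E i p.1 + (E' i p.2 - F i p.1))
      (fun i p => F' i p.2 + (F i p.1 - E' i p.2)) := by
  have fe : ∀ i b b', C.f i b = some b' → E i b' = E i b + 1 ∧ F i b = F i b' + 1 :=
    fun i b b' hb => h.of_e i b' b ((h.e_iff_f i b' b).mpr hb)
  have fe' : ∀ i b b', C'.f i b = some b' → E' i b' = E' i b + 1 ∧ F' i b = F' i b' + 1 :=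
    fun i b b' hb => h'.of_e i b' b ((h'.e_iff_f i b' b).mpr hb)
  refine ⟨fun i p => ?_, fun i p => ?_, fun i p p' hp => ?_, fun i p p' => ⟨fun hp => ?_,
    fun hp => ?_⟩⟩
  · simp only [CrystalOps.tensor, h.phi_eq, h'.eps_eq]
    split_ifs <;> simp only [Option.map_eq_none_iff, h.e_eq_none, h'.e_eq_none] <;> omega
  · simp only [CrystalOps.tensor, h.phi_eq, h'.eps_eq]
    split_ifs <;> simp only [Option.map_eq_none_iff, h.f_eq_none, h'.f_eq_none] <;> omega
  · simp only [CrystalOps.tensor, h.phi_eq, h'.eps_eq] at hp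
    split_ifs at hp <;> obtain ⟨u, hu, rfl⟩ := Option.map_eq_some_iff.mp hp
    · have := h'.of_e i _ _ hu
      dsimp only
      omega
    · have := h.of_e i _ _ hu
      dsimp only
      omega
  · simp only [CrystalOps.tensor, h.phi_eq, h'.eps_eq] at hp ⊢
    split_ifs at hp <;> obtain ⟨u, hu, rfl⟩ := Option.map_eq_some_iff.mp hp
    · have := h'.of_e i _ _ hu
      rw [if_neg (by dsimp only; omega), (h'.e_iff_f i _ _).mp hu]
      rfl
    · have := h.of_e i _ _ hu
      rw [if_pos (by dsimp only; omega), (h.e_iff_f i _ _).mp hu]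
      rfl
  · simp only [CrystalOps.tensor, h.phi_eq, h'.eps_eq] at hp ⊢
    split_ifs at hp <;> obtain ⟨u, hu, rfl⟩ := Option.map_eq_some_iff.mp hp
    · have := fe i _ _ hu
      rw [if_neg (by dsimp only; omega), (h.e_iff_f i _ _).mpr hu]
      rfl
    · have := fe' i _ _ hu
      rw [if_pos (by dsimp only; omega), (h'.e_iff_f i _ _).mpr hu]
      rfl

theorem isHighestWeight_iff (h : IsSeminormal C E F) (b : B) :
    C.IsHighestWeight b ↔ ∀ i, E i b = 0 :=
  forall_congr' fun i => h.e_eq_none i b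

/-- The last arrow leading to `b` could be undone by some `ẽ_i`, all of which kill `b`; so the path
is empty. -/
theorem eq_of_generated (h : IsSeminormal C E F) {b₀ b : B} (hb : C.Generated b₀ b)
    (hw : C.IsHighestWeight b) : b = b₀ := by
  cases hb with
  | base => rfl
  | step _ hf =>
    rw [← h.e_iff_f, hw] at hf
    cases hf

end IsSeminormal

/-! ### The vector representation -/

/-- The position of a letter in the chain `\overline n < ⋯ < \overline 1 < 1 < ⋯ < n`. -/
def code {n : ℕ} : Letter n → ℤ := Sum.elim (fun i => -(i : ℤ) - 1) (fun i => (i : ℤ))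

theorem code_injective {n : ℕ} : Function.Injective (code (n := n)) := by
  rintro (a | a) (b | b) h <;> simp only [code, Sum.elim_inl, Sum.elim_inr] at h
  · rw [show a = b from Fin.ext (by omega)]
  · omega
  · omega
  · rw [show a = b from Fin.ext (by omega)]

theorem code_bounds {n : ℕ} (x : Letter n) : -(n : ℤ) ≤ code x ∧ code x < n := by
  rcases x with a | a <;> simp only [code, Sum.elim_inl, Sum.elim_inr] <;> omega

theorem predIdx_val {n : ℕ} (i : Fin n) : ((predIdx i : Fin n) : ℕ) = i - 1 := rfl


/-- On codes, `ẽ_i` is subtraction of `1` and the colour is `|code x|`, which turns later case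
analyses into integer arithmetic. -/
theorem vectorCrystal_e {n : ℕ} (i : Fin n) (x y : Letter n) :
    (vectorCrystal n).e i x = some y ↔
      (code x = (i : ℤ) ∨ code x = -(i : ℤ)) ∧ code y = code x - 1 := by
  have hv := predIdx_val i
  rcases x with a | a <;> rcases y with b | b <;>
    simp only [vectorCrystal, code, Sum.elim_inl, Sum.elim_inr, Sum.inl.injEq, Sum.inr.injEq,
      reduceCtorEq, Fin.ext_iff, hv, if_false] <;>
    split_ifs <;>
    simp [Fin.ext_iff, hv] <;>
    omega

theorem vectorCrystal_f {n : ℕ} (i : Fin n) (x y : Letter n) :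
    (vectorCrystal n).f i x = some y ↔
      (code x = (i : ℤ) - 1 ∨ code x = -(i : ℤ) - 1) ∧ code y = code x + 1 := by
  have hv := predIdx_val i
  rcases x with a | a <;> rcases y with b | b <;>
    simp only [vectorCrystal, code, Sum.elim_inl, Sum.elim_inr, Sum.inl.injEq, Sum.inr.injEq,
      reduceCtorEq, Fin.ext_iff, hv, if_false] <;>
    split_ifs <;>
    simp [Fin.ext_iff, hv] <;>
    omega

theorem exists_code_eq {n : ℕ} {p : ℤ} (h : -(n : ℤ) ≤ p) (h' : p < n) :
    ∃ x : Letter n, code x = p := by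
  by_cases hp : 0 ≤ p
  · exact ⟨Sum.inr ⟨p.toNat, by omega⟩, by simp [code, hp]⟩
  · exact ⟨Sum.inl ⟨(-p - 1).toNat, by omega⟩, by simp [code]; omega⟩

/-- The value of `ε_i` on a letter. -/
def letterE {n : ℕ} (i : Fin n) (x : Letter n) : ℕ :=
  if code x = (i : ℤ) ∨ code x = -(i : ℤ) then 1 else 0

/-- The value of `φ_i` on a letter. -/
def letterF {n : ℕ} (i : Fin n) (x : Letter n) : ℕ :=
  if code x = (i : ℤ) - 1 ∨ code x = -(i : ℤ) - 1 then 1 else 0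

theorem vectorCrystal_e_eq_none {n : ℕ} (i : Fin n) (x : Letter n) :
    (vectorCrystal n).e i x = none ↔ letterE i x = 0 := by
  rw [Option.eq_none_iff_forall_ne_some]
  simp only [ne_eq, vectorCrystal_e, letterE]
  constructor
  · intro h
    by_contra hx
    have hx' : code x = (i : ℤ) ∨ code x = -(i : ℤ) := by
      by_contra h'; simp [h'] at hx
    obtain ⟨y, hy⟩ := exists_code_eq (n := n) (p := code x - 1) (by omega) (by omega)
    exact h y ⟨hx', hy⟩
  · rintro h y ⟨hy, -⟩
    simp [hy] at h

theorem vectorCrystal_f_eq_none {n : ℕ} (i : Fin n) (x : Letter n) :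
    (vectorCrystal n).f i x = none ↔ letterF i x = 0 := by
  rw [Option.eq_none_iff_forall_ne_some]
  simp only [ne_eq, vectorCrystal_f, letterF]
  constructor
  · intro h
    by_contra hx
    have hx' : code x = (i : ℤ) - 1 ∨ code x = -(i : ℤ) - 1 := by
      by_contra h'; simp [h'] at hx
    obtain ⟨y, hy⟩ := exists_code_eq (n := n) (p := code x + 1) (by omega) (by omega)
    exact h y ⟨hx', hy⟩
  · rintro h y ⟨hy, -⟩
    simp [hy] at h

theorem isSeminormal_vectorCrystal (n : ℕ) :
    IsSeminormal (vectorCrystal n) letterE letterF := by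
  refine ⟨vectorCrystal_e_eq_none, vectorCrystal_f_eq_none, fun i x y h => ?_, fun i x y => ?_⟩
  · rw [vectorCrystal_e] at h
    unfold letterE letterF
    split_ifs <;> omega
  · rw [vectorCrystal_e, vectorCrystal_f]
    omega

/-! ### Tensor powers -/

/-- The list of letters of a word. -/
def Word.toList {X : Type} : {l : ℕ} → Word X l → List X
  | 0, _ => []
  | _ + 1, w => w.1 :: Word.toList w.2

theorem Word.toList_ofList {X : Type} (L : List X) : (Word.ofList L).toList = L := by
  induction L with
  | nil => rfl
  | cons a L ih => exact congrArg (a :: ·) ih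

theorem Word.length_toList {X : Type} {l : ℕ} (w : Word X l) : w.toList.length = l := by
  induction l with
  | zero => rfl
  | succ l ih => exact congrArg (· + 1) (ih w.2)

theorem Word.toList_injective {X : Type} {l : ℕ} :
    Function.Injective (Word.toList : Word X l → List X) := by
  induction l with
  | zero => intro w w' _; rfl
  | succ l ih =>
    intro w w' h
    simp only [Word.toList, List.cons.injEq] at h
    exact Prod.ext h.1 (ih h.2)

theorem Word.exists_toList_eq {X : Type} {l : ℕ} (L : List X) (h : L.length = l) :
    ∃ w : Word X l, w.toList = L := by
  subst h
  exact ⟨Word.ofList L, Word.toList_ofList L⟩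

mutual

/-- The value of `ε_i` on a word. -/
def listE {n : ℕ} (i : Fin n) : List (Letter n) → ℕ
  | [] => 0
  | x :: L => letterE i x + (listE i L - letterF i x)

/-- The value of `φ_i` on a word. -/
def listF {n : ℕ} (i : Fin n) : List (Letter n) → ℕ
  | [] => 0
  | x :: L => listF i L + (letterF i x - listE i L)

end

theorem listE_nil {n : ℕ} (i : Fin n) : listE i ([] : List (Letter n)) = 0 := by
  rw [listE]

theorem listE_cons {n : ℕ} (i : Fin n) (x : Letter n) (L : List (Letter n)) :
    listE i (x :: L) = letterE i x + (listE i L - letterF i x) := by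
  rw [listE]

theorem listF_nil {n : ℕ} (i : Fin n) : listF i ([] : List (Letter n)) = 0 := by
  rw [listF]

theorem listF_cons {n : ℕ} (i : Fin n) (x : Letter n) (L : List (Letter n)) :
    listF i (x :: L) = listF i L + (letterF i x - listE i L) := by
  rw [listF]

theorem isSeminormal_wordCrystal (n l : ℕ) :
    IsSeminormal (wordCrystal n l) (fun i w => listE i w.toList) (fun i w => listF i w.toList) := by
  induction l with
  | zero =>
    refine ⟨fun i w => ?_, fun i w => ?_, fun i w w' h => (by cases h),
      fun i w w' => ⟨fun h => (by cases h), fun h => (by cases h)⟩⟩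
    · simp [wordCrystal, Word.toList, listE_nil]
    · simp [wordCrystal, Word.toList, listF_nil]
  | succ l ih =>
    have hE : (fun (i : Fin n) (w : Word (Letter n) (l + 1)) => listE i w.toList) =
        fun i p => letterE i p.1 + (listE i p.2.toList - letterF i p.1) := by
      funext i w; exact listE_cons _ _ _
    have hF : (fun (i : Fin n) (w : Word (Letter n) (l + 1)) => listF i w.toList) =
        fun i p => listF i p.2.toList + (letterF i p.1 - listE i p.2.toList) := by
      funext i w; exact listF_cons _ _ _
    rw [hE, hF]
    exact (isSeminormal_vectorCrystal n).tensor ih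

theorem wordCrystal_f_cons {n l : ℕ} (i : Fin n) (x : Letter n) (w : Word (Letter n) l)
    (u : Word (Letter n) (l + 1)) :
    (wordCrystal n (l + 1)).f i (x, w) = some u ↔
      (listE i w.toList < letterF i x ∧ ∃ y, (vectorCrystal n).f i x = some y ∧ u = (y, w)) ∨
      (letterF i x ≤ listE i w.toList ∧ ∃ w', (wordCrystal n l).f i w = some w' ∧ u = (x, w')) := by
  simp only [wordCrystal, CrystalOps.tensor, (isSeminormal_vectorCrystal n).phi_eq,
    (isSeminormal_wordCrystal n l).eps_eq]
  split_ifs with h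
  · refine Option.map_eq_some_iff.trans ⟨fun ⟨y, hy, e⟩ => Or.inl ⟨h, y, hy, e.symm⟩, ?_⟩
    rintro (⟨-, y, hy, e⟩ | ⟨h', -⟩)
    · exact ⟨y, hy, e.symm⟩
    · omega
  · refine Option.map_eq_some_iff.trans
      ⟨fun ⟨y, hy, e⟩ => Or.inr ⟨not_lt.mp h, y, hy, e.symm⟩, ?_⟩
    rintro (⟨h', -⟩ | ⟨-, y, hy, e⟩)
    · omega
    · exact ⟨y, hy, e.symm⟩

theorem wordCrystal_e_cons {n l : ℕ} (i : Fin n) (x : Letter n) (w : Word (Letter n) l)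
    (u : Word (Letter n) (l + 1)) :
    (wordCrystal n (l + 1)).e i (x, w) = some u ↔
      (letterF i x < listE i w.toList ∧ ∃ w', (wordCrystal n l).e i w = some w' ∧ u = (x, w')) ∨
      (listE i w.toList ≤ letterF i x ∧ ∃ y, (vectorCrystal n).e i x = some y ∧ u = (y, w)) := by
  simp only [wordCrystal, CrystalOps.tensor, (isSeminormal_vectorCrystal n).phi_eq,
    (isSeminormal_wordCrystal n l).eps_eq]
  split_ifs with h
  · refine Option.map_eq_some_iff.trans ⟨fun ⟨y, hy, e⟩ => Or.inl ⟨h, y, hy, e.symm⟩, ?_⟩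
    rintro (⟨-, y, hy, e⟩ | ⟨h', -⟩)
    · exact ⟨y, hy, e.symm⟩
    · omega
  · refine Option.map_eq_some_iff.trans
      ⟨fun ⟨y, hy, e⟩ => Or.inr ⟨not_lt.mp h, y, hy, e.symm⟩, ?_⟩
    rintro (⟨h', -⟩ | ⟨-, y, hy, e⟩)
    · omega
    · exact ⟨y, hy, e.symm⟩

/-! ### Rows -/

/-- Weakly decreasing lists of letters. -/
def IsRow {n : ℕ} (L : List (Letter n)) : Prop := L.Pairwise fun x y => code y ≤ code x

theorem le_add_one_of_f {n l : ℕ} {i : Fin n} {w w' : Word (Letter n) l} {p : ℤ}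
    (h : (wordCrystal n l).f i w = some w') (hp : ∀ x ∈ w.toList, code x ≤ p) :
    ∀ x ∈ w'.toList, code x ≤ p + 1 := by
  induction l with
  | zero => cases h
  | succ l ih =>
    obtain ⟨a, w⟩ := w
    simp only [Word.toList, List.forall_mem_cons] at hp
    rcases (wordCrystal_f_cons i a w w').mp h with ⟨-, y, hy, rfl⟩ | ⟨-, u, hu, rfl⟩
    · rw [vectorCrystal_f] at hy
      simp only [Word.toList, List.forall_mem_cons]
      exact ⟨by omega, fun x hx => (hp.2 x hx).trans (by omega)⟩
    · simp only [Word.toList, List.forall_mem_cons]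
      exact ⟨by omega, ih hu hp.2⟩

/-- Here `p` stands for the letter to the left of `w`, and `hE` says that `f̃_i` passes over it.
Order could break only by raising a letter equal to `p`. But raising a head equal to `p` requires
`φ_i(p) = 1` and no `ε_i` in the tail, so the whole word has `ε_i = 0`, against `hE`. -/
theorem le_of_f_of_isRow {n l : ℕ} {i : Fin n} {w w' : Word (Letter n) l} {p : Letter n}
    (h : (wordCrystal n l).f i w = some w') (hw : IsRow w.toList)
    (hp : ∀ x ∈ w.toList, code x ≤ code p) (hE : letterF i p ≤ listE i w.toList) :
    ∀ x ∈ w'.toList, code x ≤ code p := by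
  induction l with
  | zero => cases h
  | succ l ih =>
    obtain ⟨a, w⟩ := w
    simp only [Word.toList, List.forall_mem_cons] at hp ⊢
    simp only [Word.toList, IsRow, List.pairwise_cons] at hw
    simp only [Word.toList, listE_cons] at hE
    rcases (wordCrystal_f_cons i a w w').mp h with ⟨h1, y, hy, rfl⟩ | ⟨h1, u, hu, rfl⟩
    · rw [vectorCrystal_f] at hy
      have ha : code a ≠ code p := by
        intro heq
        rw [← code_injective heq] at hE
        unfold letterE at hE
        rw [if_neg (by omega)] at hE
        omega
      exact ⟨by dsimp only; omega, hp.2⟩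
    · refine ⟨hp.1, ?_⟩
      by_cases ha : code a = code p
      · have := code_injective ha
        subst this
        exact ih hu hw.2 hp.2 h1
      · intro x hx
        have := le_add_one_of_f hu hw.1 x hx
        omega

theorem isRow_of_f {n l : ℕ} {i : Fin n} {w w' : Word (Letter n) l}
    (h : (wordCrystal n l).f i w = some w') (hw : IsRow w.toList) : IsRow w'.toList := by
  induction l with
  | zero => cases h
  | succ l ih =>
    obtain ⟨a, w⟩ := w
    simp only [Word.toList, IsRow, List.pairwise_cons] at hw
    rcases (wordCrystal_f_cons i a w w').mp h with ⟨-, y, hy, rfl⟩ | ⟨h1, u, hu, rfl⟩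
    · rw [vectorCrystal_f] at hy
      simp only [Word.toList, IsRow, List.pairwise_cons]
      exact ⟨fun x hx => (hw.1 x hx).trans (by omega), hw.2⟩
    · simp only [Word.toList, IsRow, List.pairwise_cons]
      exact ⟨le_of_f_of_isRow hu hw.2 hw.1 h1, ih hu hw.2⟩

theorem le_of_e {n l : ℕ} {i : Fin n} {w w' : Word (Letter n) l} {p : ℤ}
    (h : (wordCrystal n l).e i w = some w') (hp : ∀ x ∈ w.toList, code x ≤ p) :
    ∀ x ∈ w'.toList, code x ≤ p := by
  induction l with
  | zero => cases h
  | succ l ih =>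
    obtain ⟨a, w⟩ := w
    simp only [Word.toList, List.forall_mem_cons] at hp
    rcases (wordCrystal_e_cons i a w w').mp h with ⟨-, u, hu, rfl⟩ | ⟨-, y, hy, rfl⟩
    · simp only [Word.toList, List.forall_mem_cons]
      exact ⟨hp.1, ih hu hp.2⟩
    · rw [vectorCrystal_e] at hy
      simp only [Word.toList, List.forall_mem_cons]
      exact ⟨by omega, hp.2⟩

/-- If `ẽ_i` lowers the head `a`, then `φ_i(a) = 0`, so the tail has `ε_i = 0` and cannot begin with
`a`. The tail is then strictly below `a`, and lowering `a` by one is harmless. -/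
theorem isRow_of_e {n l : ℕ} {i : Fin n} {w w' : Word (Letter n) l}
    (h : (wordCrystal n l).e i w = some w') (hw : IsRow w.toList) : IsRow w'.toList := by
  induction l with
  | zero => cases h
  | succ l ih =>
    obtain ⟨a, w⟩ := w
    simp only [Word.toList, IsRow, List.pairwise_cons] at hw
    rcases (wordCrystal_e_cons i a w w').mp h with ⟨h1, u, hu, rfl⟩ | ⟨h1, y, hy, rfl⟩
    · simp only [Word.toList, IsRow, List.pairwise_cons]
      exact ⟨le_of_e hu hw.1, ih hu hw.2⟩
    · rw [vectorCrystal_e] at hy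
      simp only [Word.toList, IsRow, List.pairwise_cons]
      refine ⟨fun x hx => ?_, hw.2⟩
      have hF : letterF i a = 0 := by unfold letterF; rw [if_neg]; omega
      cases hL : w.toList with
      | nil => rw [hL] at hx; cases hx
      | cons b L =>
        rw [hL] at hw h1 hx
        rw [hF, listE_cons] at h1
        have hb : code b ≠ code a := by
          intro hb
          rw [code_injective hb] at h1
          unfold letterE at h1
          rw [if_pos hy.1] at h1
          omega
        have hba := hw.1 b (by simp)
        rcases List.mem_cons.mp hx with rfl | hx
        · omega
        · have := (List.pairwise_cons.mp hw.2).1 x hx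
          omega

theorem sum_code_of_e {n l : ℕ} {i : Fin n} {w w' : Word (Letter n) l}
    (h : (wordCrystal n l).e i w = some w') :
    (w'.toList.map fun x => (code x + n).toNat).sum + 1 =
      (w.toList.map fun x => (code x + n).toNat).sum := by
  induction l with
  | zero => cases h
  | succ l ih =>
    obtain ⟨a, w⟩ := w
    rcases (wordCrystal_e_cons i a w w').mp h with ⟨h1, u, hu, rfl⟩ | ⟨h1, y, hy, rfl⟩
    · simp only [Word.toList, List.map_cons, List.sum_cons]
      have := ih hu
      omega
    · rw [vectorCrystal_e] at hy
      simp only [Word.toList, List.map_cons, List.sum_cons]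
      have := (code_bounds y).1
      have := (code_bounds a).1
      omega

theorem IsRow.code_eq_of_listE_eq_zero {n : ℕ} {L : List (Letter n)} (hL : IsRow L)
    (h : ∀ i, listE i L = 0) : ∀ x ∈ L, code x = -(n : ℤ) := by
  cases L with
  | nil => simp
  | cons a L =>
    have ha : code a = -(n : ℤ) := by
      by_contra hne
      obtain ⟨h1, h2⟩ := code_bounds a
      -- Every letter above the bottom one is lowered by the colour `|code a| < n`, and the head's
      -- `ε` is never cancelled.
      have := h ⟨(code a).natAbs, by omega⟩
      rw [listE_cons, letterE, if_pos (by simp only; omega)] at this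
      omega
    intro x hx
    rcases List.mem_cons.mp hx with rfl | hx
    · exact ha
    · have := (List.pairwise_cons.mp hL).1 x hx
      have := (code_bounds x).1
      omega

/-- Both operators preserve rows. From any row, applying `ẽ_i`'s lowers the sum of codes until all
of them vanish, which happens only at the constant word `w₀`; reversing the arrows generates the
row. -/
theorem generated_iff_isRow {n l : ℕ} {w₀ : Word (Letter n) l}
    (h₀ : ∀ x ∈ w₀.toList, code x = -(n : ℤ)) (w : Word (Letter n) l) :
    (wordCrystal n l).Generated w₀ w ↔ IsRow w.toList := by
  have hrow : IsRow w₀.toList :=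
    List.pairwise_of_forall_mem_list fun x hx y hy => by rw [h₀ x hx, h₀ y hy]
  constructor
  · intro h
    induction h with
    | base => exact hrow
    | step _ hf ih => exact isRow_of_f hf ih
  · intro h
    induction hs : (w.toList.map fun x => (code x + n).toNat).sum using Nat.strong_induction_on
      generalizing w with
    | _ s ih =>
      have hsn := isSeminormal_wordCrystal n l
      by_cases hw : ∀ i, listE i w.toList = 0
      · have h1 := h.code_eq_of_listE_eq_zero hw
        have : w = w₀ := by
          refine Word.toList_injective (List.ext_getElem ?_ fun k hk hk' => code_injective ?_)
          · rw [Word.length_toList, Word.length_toList]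
          · rw [h1 _ (List.getElem_mem hk), h₀ _ (List.getElem_mem hk')]
        rw [this]
        exact .base
      · push Not at hw
        obtain ⟨i, hi⟩ := hw
        obtain ⟨w', hw'⟩ := Option.ne_none_iff_exists'.mp (mt (hsn.e_eq_none i w).mp hi)
        have hlt := sum_code_of_e hw'
        exact .step (ih _ (by omega) w' (isRow_of_e hw' h) rfl) ((hsn.e_iff_f i w w').mp hw')

instance {n : ℕ} : LawfulBEq (Letter n) where
  rfl {a} := by cases a <;> exact beq_self_eq_true (α := Fin n) _
  eq_of_beq {a b} h := by
    cases a <;> cases b <;> first | exact congrArg _ (eq_of_beq (α := Fin n) h) | cases h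

theorem inl_code {n : ℕ} (i : Fin n) : code (Sum.inl i : Letter n) = -(i : ℤ) - 1 := rfl

/-- In a decreasing word the letters seen by colour `i ≥ 1` come in the order `i+1, i, \overline i,
\overline{i+1}`, contributing to `ε, φ, ε, φ`; only the letters `i` cancel letters `\overline i`.
For `i = 0` the letters `1` precede `\overline 1` and nothing cancels. -/
theorem IsRow.listE_eq {n : ℕ} {L : List (Letter n)} (hL : IsRow L) (i : Fin n) :
    listE i L = if (i : ℕ) = 0 then L.count (.inr i) else
      L.count (.inr i) + (L.count (.inl (predIdx i)) - L.count (.inr (predIdx i))) := by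
  induction L with
  | nil => simp [listE_nil]
  | cons a L ih =>
    rw [IsRow, List.pairwise_cons] at hL
    have h0 : ∀ x : Letter n, code a < code x → L.count x = 0 := by
      intro x hx
      rw [List.count_eq_zero]
      intro hm
      have := hL.1 x hm
      omega
    have hc : ∀ x : Letter n, (a :: L).count x = L.count x + if code a = code x then 1 else 0 := by
      intro x
      simp only [List.count_cons, beq_iff_eq, code_injective.eq_iff]
    have hv := predIdx_val i
    have e1 : code a < (i : ℤ) → L.count (.inr i) = 0 := h0 (.inr i)
    have e2 : code a < -((predIdx i : ℕ) : ℤ) - 1 → L.count (.inl (predIdx i)) = 0 :=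
      h0 (.inl (predIdx i))
    have e3 : code a < ((predIdx i : ℕ) : ℤ) → L.count (.inr (predIdx i)) = 0 :=
      h0 (.inr (predIdx i))
    have c1 : (a :: L).count (.inr i) = L.count (.inr i) + if code a = (i : ℤ) then 1 else 0 :=
      hc _
    have c2 : (a :: L).count (.inr (predIdx i)) = L.count (.inr (predIdx i)) +
      if code a = ((predIdx i : ℕ) : ℤ) then 1 else 0 := hc _
    have c3 : (a :: L).count (.inl (predIdx i)) = L.count (.inl (predIdx i)) +
      if code a = -((predIdx i : ℕ) : ℤ) - 1 then 1 else 0 := hc _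
    rw [listE_cons, c1, c2, c3, ih hL.2, letterE, letterF]
    split_ifs <;> omega

/-! ### Weights of words -/

theorem fundCoeff_add {n : ℕ} (β γ : Weight n) (i : Fin n) :
    fundCoeff (β + γ) i = fundCoeff β i + fundCoeff γ i := by
  unfold fundCoeff
  split_ifs <;> simp only [Pi.add_apply] <;> ring

/-- The sum telescopes, since `fundCoeff` takes successive differences. -/
theorem sum_fundCoeff {n : ℕ} (β : Weight n) : ∑ i, fundCoeff β i • fundWeight i = β := by
  have key : ∀ (m : ℕ) (j : Fin n), (j : ℕ) = m →
      ∑ i, (if i ≤ j then fundCoeff β i else 0) = β j := by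
    intro m
    induction m with
    | zero =>
      intro j hj
      rw [Finset.sum_eq_single j]
      · simp [fundCoeff, hj]
      · intro b _ hb
        rw [if_neg]
        intro h
        exact hb (Fin.ext (by have : (b : ℕ) ≤ j := h; omega))
      · simp
    | succ m ih =>
      intro j hj
      have hp := ih (predIdx j) (by rw [predIdx_val]; omega)
      have : ∀ i, (if i ≤ j then fundCoeff β i else 0) =
          (if i ≤ predIdx j then fundCoeff β i else 0) + if i = j then fundCoeff β j else 0 := by
        intro i
        simp only [Fin.le_def, Fin.ext_iff, predIdx_val]
        split_ifs with h1 h2 h3 h4 h5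
        all_goals first | omega | skip
        rw [show i = j from Fin.ext h4, zero_add]
      simp only [this, Finset.sum_add_distrib, hp]
      simp [fundCoeff, hj]
  ext j
  rw [Finset.sum_apply, ← key j j rfl]
  refine Finset.sum_congr rfl fun i _ => ?_
  simp [fundWeight]

/-- The weight of a word. -/
def listWeight {n : ℕ} (L : List (Letter n)) : Weight n := countWeight fun x => L.count x

theorem listWeight_append {n : ℕ} (L L' : List (Letter n)) :
    listWeight (L ++ L') = listWeight L + listWeight L' := by
  ext j
  simp only [listWeight, countWeight, List.count_append, Pi.add_apply]
  push_cast
  ring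

theorem listWeight_nil {n : ℕ} : listWeight ([] : List (Letter n)) = 0 := by
  ext j
  simp [listWeight, countWeight]

theorem fundCoeff_listWeight_singleton {n : ℕ} (x : Letter n) (i : Fin n) :
    fundCoeff (listWeight [x]) i = letterF i x - letterE i x := by
  have hv := predIdx_val i
  have hc : ∀ y : Letter n, [x].count y = if code x = code y then 1 else 0 := by
    intro y
    simp only [List.count_singleton, beq_iff_eq, code_injective.eq_iff]
  have c1 : [x].count (.inr i) = if code x = (i : ℤ) then 1 else 0 := hc _
  have c2 : [x].count (.inl i) = if code x = -(i : ℤ) - 1 then 1 else 0 := hc _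
  have c3 : [x].count (.inr (predIdx i)) = if code x = ((predIdx i : ℕ) : ℤ) then 1 else 0 := hc _
  have c4 : [x].count (.inl (predIdx i)) = if code x = -((predIdx i : ℕ) : ℤ) - 1 then 1 else 0 :=
    hc _
  simp only [fundCoeff, listWeight, countWeight, c1, c2, c3, c4, letterF, letterE]
  split_ifs <;> omega

theorem fundCoeff_listWeight {n : ℕ} (L : List (Letter n)) (i : Fin n) :
    fundCoeff (listWeight L) i = listF i L - listE i L := by
  induction L with
  | nil => simp [listWeight_nil, listE_nil, listF_nil, fundCoeff]
  | cons x L ih =>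
    rw [← List.singleton_append, listWeight_append, fundCoeff_add, fundCoeff_listWeight_singleton,
      ih, List.singleton_append, listE_cons, listF_cons]
    omega

theorem listE_append {n : ℕ} (i : Fin n) (L L' : List (Letter n)) :
    listE i (L ++ L') = listE i L + (listE i L' - listF i L) ∧
      listF i (L ++ L') = listF i L' + (listF i L - listE i L') := by
  induction L with
  | nil => simp [listE_nil, listF_nil]
  | cons x L ih =>
    simp only [List.cons_append, listE_cons, listF_cons, ih]
    omega

theorem listE_append_eq_zero {n : ℕ} {i : Fin n} {L L' : List (Letter n)} (h : listE i L = 0)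
    (h' : listE i L' = 0) : listE i (L ++ L') = 0 := by
  rw [(listE_append i L L').1, h, h', Nat.zero_sub]

/-! ### Highest weight words -/

/-- In a column of barred letters, `\overline{i+1}` stands to the left of `\overline i` and cancels
its `ε_i`. -/
theorem listE_of_pairwise_lt {n : ℕ} {L : List (Letter n)}
    (hL : L.Pairwise fun x y => code x < code y) (h0 : ∀ x ∈ L, code x < 0) (i : Fin n) :
    listE i L = if (∃ x ∈ L, code x = -(i : ℤ)) ∧ ∀ x ∈ L, code x ≠ -(i : ℤ) - 1 then 1 else 0 := by
  induction L with
  | nil => simp [listE_nil]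
  | cons a L ih =>
    rw [List.pairwise_cons] at hL
    rw [List.forall_mem_cons] at h0
    rw [listE_cons, ih hL.2 h0.2, letterE, letterF]
    simp only [List.exists_mem_cons_iff, List.forall_mem_cons]
    by_cases h1 : code a = -(i : ℤ)
    · have h2 : ∀ x ∈ L, code x ≠ -(i : ℤ) - 1 := fun x hx => by have := hL.1 x hx; omega
      have h3 : ¬ ∃ x ∈ L, code x = -(i : ℤ) := by
        rintro ⟨x, hx, h⟩
        have := hL.1 x hx
        omega
      rw [if_pos (Or.inr h1), if_neg fun h => h3 h.1, Nat.zero_sub]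
      exact (if_pos ⟨Or.inl h1, by omega, h2⟩).symm
    · have h1' : ¬ (code a = (i : ℤ) ∨ code a = -(i : ℤ)) := by omega
      by_cases h2 : code a = -(i : ℤ) - 1
      · rw [if_neg h1', if_pos (Or.inr h2), zero_add]
        refine Eq.trans ?_ (if_neg fun h => h.2.1 h2).symm
        split_ifs <;> rfl
      · rw [if_neg h1', if_neg (c := code a = (i : ℤ) - 1 ∨ _) (by omega), zero_add, Nat.sub_zero]
        simp only [h1, h2, false_or, not_false_eq_true, true_and, ne_eq]

theorem mem_hwColumn {n : ℕ} {p : Fin n} {x : Letter n} :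
    x ∈ hwColumn p ↔ ∃ j, p ≤ j ∧ x = Sum.inl j := by
  simp [hwColumn, eq_comm]

theorem pairwise_hwColumn {n : ℕ} (p : Fin n) :
    (hwColumn p).Pairwise fun x y => code x < code y := by
  rw [hwColumn, List.pairwise_map]
  refine List.Pairwise.filter _ ?_
  rw [List.pairwise_reverse]
  refine (List.sortedLT_finRange n).pairwise.imp fun {a b} hab => ?_
  have : (a : ℕ) < b := hab
  simp only [inl_code]
  omega

theorem listE_hwColumn {n : ℕ} (i p : Fin n) : listE i (hwColumn p) = 0 := by
  rw [listE_of_pairwise_lt (pairwise_hwColumn p), if_neg]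
  · rintro ⟨⟨x, hx, hxi⟩, h⟩
    obtain ⟨j, hj, rfl⟩ := mem_hwColumn.mp hx
    rw [inl_code] at hxi
    refine h (Sum.inl i) (mem_hwColumn.mpr ⟨i, hj.trans ?_, rfl⟩) (inl_code i)
    rw [Fin.le_def]; omega
  · intro x hx
    obtain ⟨j, -, rfl⟩ := mem_hwColumn.mp hx
    rw [inl_code]; omega

theorem listWeight_hwColumn {n : ℕ} (p : Fin n) : listWeight (hwColumn p) = fundWeight p := by
  have hnd : (hwColumn p).Nodup := (pairwise_hwColumn p).imp fun h h' => by rw [h'] at h; omega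
  ext j
  simp [listWeight, countWeight, fundWeight, hnd.count, mem_hwColumn]

theorem listE_flatten {n : ℕ} (i : Fin n) (Ls : List (List (Letter n)))
    (h : ∀ L ∈ Ls, listE i L = 0) : listE i Ls.flatten = 0 := by
  induction Ls with
  | nil => exact listE_nil i
  | cons L Ls ih =>
    rw [List.forall_mem_cons] at h
    exact listE_append_eq_zero h.1 (ih h.2)

theorem listWeight_flatten {n : ℕ} (Ls : List (List (Letter n))) :
    listWeight Ls.flatten = (Ls.map listWeight).sum := by
  induction Ls with
  | nil => exact listWeight_nil
  | cons L Ls ih => rw [List.flatten_cons, listWeight_append, ih, List.map_cons, List.sum_cons]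

theorem listE_hwWord {n : ℕ} (β : Weight n) (i : Fin n) : listE i (hwWord β) = 0 := by
  rw [hwWord, List.flatMap_def]
  refine listE_flatten i _ fun L hL => ?_
  obtain ⟨p, -, rfl⟩ := List.mem_map.mp hL
  refine listE_flatten i _ fun L' hL' => ?_
  rw [List.eq_of_mem_replicate hL']
  exact listE_hwColumn i p

theorem listWeight_hwWord {n : ℕ} {β : Weight n} (h : ∀ p, 0 ≤ fundCoeff β p) :
    listWeight (hwWord β) = β := by
  have h1 : ∀ p, listWeight (List.replicate (fundCoeff β p).toNat (hwColumn p)).flatten =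
      fundCoeff β p • fundWeight p := by
    intro p
    rw [listWeight_flatten, List.map_replicate, List.sum_replicate, listWeight_hwColumn,
      ← natCast_zsmul, Int.toNat_of_nonneg (h p)]
  rw [hwWord, List.flatMap_def, listWeight_flatten, List.map_map]
  simp only [Function.comp_def, h1]
  rw [List.map_reverse, List.sum_reverse, ← List.ofFn_eq_map, List.sum_ofFn, sum_fundCoeff]

theorem IsDominant.fundCoeff_nonneg {n : ℕ} {β : Weight n} (h : IsDominant β) (p : Fin n) :
    0 ≤ fundCoeff β p := by
  unfold fundCoeff
  split_ifs
  · exact h.2 p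
  · have : predIdx p ≤ p := by rw [Fin.le_def, predIdx_val]; omega
    have := h.1 this
    omega

theorem fundCoeff_rowWeight {n : ℕ} (r : ℕ) (p : Fin n) :
    fundCoeff (rowWeight n r) p = if (p : ℕ) + 1 = n then (r : ℤ) else 0 := by
  have := predIdx_val p
  simp only [fundCoeff, rowWeight]
  split_ifs <;> omega

theorem code_of_mem_hwWord_rowWeight {n r : ℕ} {x : Letter n} (hx : x ∈ hwWord (rowWeight n r)) :
    code x = -(n : ℤ) := by
  simp only [hwWord, List.mem_flatMap, List.mem_flatten, List.mem_replicate, fundCoeff_rowWeight]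
    at hx
  obtain ⟨p, -, L, ⟨hp, rfl⟩, hx⟩ := hx
  obtain ⟨j, hj, rfl⟩ := mem_hwColumn.mp hx
  rw [inl_code]
  split_ifs at hp
  · rw [Fin.le_def] at hj
    omega
  · simp at hp

theorem length_hwWord_rowWeight {n : ℕ} (hn : 1 ≤ n) (r : ℕ) :
    (hwWord (rowWeight n r)).length = r := by
  have h1 := listWeight_hwWord (β := rowWeight n r) (fun p => by
    rw [fundCoeff_rowWeight]; split_ifs <;> omega)
  have hall : ∀ x ∈ hwWord (rowWeight n r), x = Sum.inl ⟨n - 1, by omega⟩ := by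
    intro x hx
    refine code_injective ?_
    rw [code_of_mem_hwWord_rowWeight hx, inl_code]
    simp only
    omega
  have h2 := congrFun h1 ⟨n - 1, by omega⟩
  rw [List.eq_replicate_of_mem hall] at h2
  simpa [listWeight, countWeight, List.count_replicate, rowWeight,
    show n - 1 + 1 = n by omega] using h2

/-! ### The components of `B(γ) ⊗ B((r))` -/

theorem wt_tensor_wordCrystal {n l l' : ℕ} (b : Word (Letter n) l × Word (Letter n) l') :
    ((wordCrystal n l).tensor (wordCrystal n l')).wt b =
      listWeight b.1.toList + listWeight b.2.toList := by
  have h := (isSeminormal_wordCrystal n l).tensor (isSeminormal_wordCrystal n l')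
  rw [CrystalOps.wt, ← sum_fundCoeff (listWeight b.1.toList + listWeight b.2.toList)]
  refine Finset.sum_congr rfl fun i _ => ?_
  rw [h.phi_eq, h.eps_eq, fundCoeff_add, fundCoeff_listWeight, fundCoeff_listWeight]
  congr 1
  omega

/-- The truncated expression for `ε_i` is a maximum of two quantities; bounding them separately
gives the removal and the addition condition. -/
theorem IsRow.isPieri_iff {n : ℕ} {L : List (Letter n)} (hL : IsRow L) (γ : Weight n) :
    IsPieri γ (fun x => L.count x) ↔ ∀ i, (listE i L : ℤ) ≤ fundCoeff γ i := by
  refine forall_congr' fun i => ?_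
  rw [hL.listE_eq, RemovalFails, AdditionFails, fundCoeff]
  split_ifs with h
  · simp only [h, ne_eq, not_true_eq_false, false_and, not_false_eq_true, and_true]
    omega
  · simp only [h, ne_eq, not_false_eq_true, true_and]
    omega

/-- A tensor `u ⊗ w` is a highest weight vertex iff `u` is one and `ε_i(w) ≤ φ_i(u)` for all `i`.
The first condition forces `u = b_γ`, where `φ_i` is the coefficient of `γ` on `Λ_i`. -/
theorem mem_componentVertices_iff {n : ℕ} {γ : Weight n} (hγ : IsDominant γ) (r : ℕ)
    (b : Word (Letter n) (hwWord γ).length ×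
      Word (Letter n) (hwWord (rowWeight n r)).length) :
    b ∈ componentVertices γ (rowWeight n r) ↔
      b.1 = Word.ofList (hwWord γ) ∧ IsRow b.2.toList ∧ IsPieri γ (fun x => b.2.toList.count x) := by
  have h1 := isSeminormal_wordCrystal n (hwWord γ).length
  have h2 := isSeminormal_wordCrystal n (hwWord (rowWeight n r)).length
  have hrow : b.2 ∈ crystalB (rowWeight n r) ↔ IsRow b.2.toList :=
    generated_iff_isRow (fun x hx => by
      rw [Word.toList_ofList] at hx
      exact code_of_mem_hwWord_rowWeight hx) b.2
  have hF : ∀ i, (listF i (hwWord γ) : ℤ) = fundCoeff γ i := by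
    intro i
    have h := fundCoeff_listWeight (hwWord γ) i
    rw [listWeight_hwWord hγ.fundCoeff_nonneg, listE_hwWord] at h
    simpa using h.symm
  rw [componentVertices, Set.mem_ofPred_eq, hrow, (h1.tensor h2).isHighestWeight_iff]
  constructor
  · rintro ⟨hb1, hb2, hw⟩
    have hw1 : b.1 = Word.ofList (hwWord γ) := by
      refine h1.eq_of_generated hb1 ((h1.isHighestWeight_iff _).mpr fun i => ?_)
      have := hw i
      omega
    refine ⟨hw1, hb2, (hb2.isPieri_iff γ).mpr fun i => ?_⟩
    have := hw i
    rw [hw1, Word.toList_ofList] at this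
    rw [← hF]
    omega
  · rintro ⟨hw1, hb2, hp⟩
    refine ⟨by rw [hw1]; exact .base, hb2, fun i => ?_⟩
    have := (hb2.isPieri_iff γ).mp hp i
    rw [← hF] at this
    rw [hw1, Word.toList_ofList, listE_hwWord]
    omega

theorem sum_count_eq_length {n : ℕ} (L : List (Letter n)) : ∑ x, L.count x = L.length := by
  have := Multiset.sum_count_eq_card (s := Finset.univ) (m := (L : Multiset (Letter n)))
    (fun a _ => Finset.mem_univ a)
  simp only [Multiset.coe_count, Multiset.coe_card] at this
  convert this

theorem exists_isRow_count {n : ℕ} (k : Letter n → ℕ) :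
    ∃ L : List (Letter n), IsRow L ∧ ∀ x, L.count x = k x := by
  classical
  let R : Letter n → Letter n → Prop := fun x y => code y ≤ code x
  have : Std.Total R := ⟨fun a b => le_total _ _⟩
  have : IsTrans _ R := ⟨fun a b c h h' => le_trans h' h⟩
  refine ⟨((Finsupp.toMultiset (Finsupp.equivFunOnFinite.symm k)).toList).insertionSort R,
    List.pairwise_insertionSort R _, fun x => ?_⟩
  rw [(List.perm_insertionSort R _).count_eq]
  have := Finsupp.count_toMultiset (Finsupp.equivFunOnFinite.symm k) x
  rw [← Multiset.coe_toList (Finsupp.toMultiset _), Multiset.coe_count] at this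
  convert this
  rfl

/-- Counting letters is a bijection from decreasing words of length `r` to multisets of size `r`,
with sorting as inverse. -/
theorem sumOverComponents_rowWeight {n : ℕ} (hn : 1 ≤ n) {A : Type*} [AddCommMonoid A]
    {γ : Weight n} (hγ : IsDominant γ) (r : ℕ) (g : Weight n → A) (T : Finset (Letter n → ℕ))
    (hT : ∀ k, k ∈ T ↔ k ∈ Finset.piAntidiag Finset.univ r ∧ IsPieri γ k) :
    sumOverComponents γ (rowWeight n r) g = ∑ k ∈ T, g (γ + countWeight k) := by
  rw [sumOverComponents, ← finsum_mem_coe_finset]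
  refine finsum_mem_eq_of_bijOn (fun b x => b.2.toList.count x) ⟨?_, ?_, ?_⟩ ?_
  · intro b hb
    rw [mem_componentVertices_iff hγ] at hb
    rw [Finset.mem_coe, hT, Finset.mem_piAntidiag]
    refine ⟨⟨?_, by simp⟩, hb.2.2⟩
    rw [sum_count_eq_length, Word.length_toList, length_hwWord_rowWeight hn]
  · intro b hb b' hb' h
    rw [mem_componentVertices_iff hγ] at hb hb'
    refine Prod.ext (hb.1.trans hb'.1.symm) (Word.toList_injective ?_)
    refine List.Perm.eq_of_pairwise (fun x y _ _ hxy hyx => code_injective (le_antisymm hyx hxy))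
      hb.2.1 hb'.2.1 (List.perm_iff_count.mpr fun x => congrFun h x)
  · intro k hk
    rw [Finset.mem_coe, hT, Finset.mem_piAntidiag] at hk
    obtain ⟨L, hL, hc⟩ := exists_isRow_count k
    obtain ⟨w, hw⟩ := Word.exists_toList_eq (l := (hwWord (rowWeight n r)).length) L (by
      rw [length_hwWord_rowWeight hn, ← sum_count_eq_length, ← hk.1.1]
      exact Finset.sum_congr rfl fun x _ => hc x)
    have hk' : (fun x => w.toList.count x) = k := by
      funext x
      rw [hw, hc]
    refine ⟨(Word.ofList (hwWord γ), w), ?_, hk'⟩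
    rw [mem_componentVertices_iff hγ]
    exact ⟨rfl, hw ▸ hL, by simpa only [hk'] using hk.2⟩
  · intro b hb
    rw [mem_componentVertices_iff hγ] at hb
    rw [wt_tensor_wordCrystal, hb.1, Word.toList_ofList, listWeight_hwWord hγ.fundCoeff_nonneg]
    rfl

/-- The Pieri rule: for antisymmetric `g`, the sum of `g` over the components of
`B(γ) ⊗ B((r))` is the sum of `g (γ + ν)` over the weights `ν` of `B((r))`. -/
theorem sumOverComponents_rowWeight_of_antisymm {n : ℕ} (hn : 1 ≤ n) {A : Type*} [AddCommGroup A]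
    {γ : Weight n} (hγ : IsDominant γ) (r : ℕ) {g : Weight n → A} (hg : Antisymm g) :
    sumOverComponents γ (rowWeight n r) (fun x => g (x + rho n)) =
      ∑ k ∈ Finset.piAntidiag Finset.univ r, g (γ + countWeight k + rho n) := by
  classical
  rw [sumOverComponents_rowWeight hn hγ r _
    ((Finset.piAntidiag Finset.univ r).filter (IsPieri γ)) fun k => Finset.mem_filter]
  exact (sum_countWeight_eq_sum_isPieri hg hγ r _ fun k => Finset.mem_filter).symm

/-! ### Torsion-freeness and antisymmetric families -/

instance {n : ℕ} : IsAddTorsionFree (GroupRing n) :=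
  Function.Injective.isAddTorsionFree
    (AddMonoidAlgebra.coeffAddEquiv : GroupRing n ≃+ (Weight n →₀ ℤ)).toAddMonoidHom
    AddMonoidAlgebra.coeffAddEquiv.injective

instance : IsAddTorsionFree (PowerSeries ℤ) :=
  Function.Injective.isAddTorsionFree
    (⟨⟨fun f N => PowerSeries.coeff N f, by ext; simp⟩, fun f g => by ext; simp⟩ :
      PowerSeries ℤ →+ (ℕ → ℤ))
    (fun _ _ h => PowerSeries.ext fun N => congrFun h N)

/-- The alternating sum defining the Kostka-Foulkes polynomials, as a function of `λ + ρ`. -/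
def kostkaSum {n : ℕ} (mu x : Weight n) : PowerSeries ℤ :=
  ∑ σ : weylGroup n, sgn σ • qPartition (act σ x - (mu + rho n))

theorem kostkaFoulkes_eq {n : ℕ} (lam mu : Weight n) :
    kostkaFoulkes lam mu = kostkaSum mu (lam + rho n) := rfl

theorem antisymm_kostkaSum {n : ℕ} (mu : Weight n) : Antisymm (kostkaSum mu) :=
  antisymm_sum_act fun x => qPartition (x - (mu + rho n))

theorem coeff_kostkaSum {n : ℕ} (a : ℕ) (mu x : Weight n) :
    PowerSeries.coeff a (kostkaSum mu x) = ∑ σ : weylGroup n,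
      sgn σ * (PowerSeries.coeff a (kostantSeries n)).coeff (act σ x - (mu + rho n)) := by
  rw [kostkaSum, map_sum]
  refine Finset.sum_congr rfl fun σ _ => ?_
  rw [map_zsmul, smul_eq_mul, qPartition, PowerSeries.coeff_mk]

theorem antisymm_alternant (n : ℕ) : Antisymm (alternant (n := n)) :=
  antisymm_sum_act xpow

/-- The Schur function `s_β`, as a function of `β + ρ`. -/
def schurRho {n : ℕ} (x : Weight n) : FracField n :=
  algebraMap (GroupRing n) (FracField n) (alternant x) /
    algebraMap (GroupRing n) (FracField n) (alternant (rho n))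

theorem schur_eq {n : ℕ} (β : Weight n) : schur β = schurRho (β + rho n) := rfl

theorem antisymm_schurRho (n : ℕ) : Antisymm (schurRho (n := n)) := by
  refine ⟨fun i x => ?_, fun i x h => ?_⟩
  · rw [schurRho, (antisymm_alternant n).map_reflection, map_neg, neg_div]; rfl
  · rw [schurRho, (antisymm_alternant n).eq_zero i x h, map_zero, zero_div]

-- The reflections of `C_n` inside those of `C_{n+1}`.

theorem act_reflection_snoc {n : ℕ} (i : Fin n) (x : Weight n) (d : ℤ) :
    act (reflection i.castSucc) (Fin.snoc x d : Weight (n + 1)) =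
      Fin.snoc (act (reflection i) x) d := by
  ext j
  by_cases hi : (i : ℕ) = 0
  · rw [act_reflection_zero _ (by simpa using hi)]
    cases j using Fin.lastCases with
    | last => simp [(Fin.castSucc_lt_last i).ne']
    | cast j => simp [act_reflection_zero i hi]
  · have hp : predIdx i.castSucc = (predIdx i).castSucc := rfl
    rw [act_reflection_pos _ (by simpa using hi), hp]
    cases j using Fin.lastCases with
    | last =>
      rw [Equiv.swap_apply_of_ne_of_ne (Fin.castSucc_lt_last _).ne' (Fin.castSucc_lt_last _).ne']
      simp
    | cast j =>
      rw [← (Fin.castSucc_injective n).map_swap]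
      simp [act_reflection_pos i hi]

/-- The simple reflections of `C_n` are among those of `C_{n+1}` and fix the last index, so
antisymmetry survives freezing `d`. This is the function to be folded. -/
theorem antisymm_schurRho_snoc {n : ℕ} (d : ℤ) :
    Antisymm (fun x : Weight n => schurRho (Fin.snoc x d : Weight (n + 1))) := by
  refine ⟨fun i x => ?_, fun i x h => ?_⟩
  · rw [← act_reflection_snoc, (antisymm_schurRho _).map_reflection]
  · refine (antisymm_schurRho _).eq_zero i.castSucc _ ?_
    rw [act_reflection_snoc, h]

theorem snoc_add_rho {n : ℕ} (x : Weight n) (d : ℤ) :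
    (Fin.snoc x d : Weight (n + 1)) + rho (n + 1) = Fin.snoc (x + rho n) (d + (n + 1)) := by
  ext j
  cases j using Fin.lastCases <;> simp [rho]

theorem schur_snoc {n : ℕ} (x : Weight n) (d : ℤ) :
    schur (Fin.snoc x d : Weight (n + 1)) = schurRho (Fin.snoc (x + rho n) (d + (n + 1))) := by
  rw [schur_eq, snoc_add_rho]

/-! ### Linear extension and the folded sum -/

/-- The additive extension of a function on weights to the group ring. -/
def linExt {n : ℕ} {A : Type*} [AddCommGroup A] (f : Weight n → A) : GroupRing n →+ A :=
  (Finsupp.liftAddHom fun β => zmultiplesHom A (f β)).comp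
    (AddMonoidAlgebra.coeffAddEquiv : GroupRing n ≃+ (Weight n →₀ ℤ)).toAddMonoidHom

theorem linExt_xpow {n : ℕ} {A : Type*} [AddCommGroup A] (f : Weight n → A) (β : Weight n) :
    linExt f (xpow β) = f β := by
  refine (Finsupp.sum_single_index ?_).trans ?_ <;> simp

theorem linExt_apply {n : ℕ} {A : Type*} [AddCommGroup A] (f : Weight n → A) (y : GroupRing n) :
    linExt f y = ∑ᶠ β, y.coeff β • f β := by
  rw [finsum_eq_sum_of_support_subset (s := y.coeff.support)]
  · rfl
  · intro β hβ
    rw [Finset.mem_coe, Finsupp.mem_support_iff]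
    intro h
    simp [h] at hβ

theorem act_countWeight {n : ℕ} (σ : weylGroup n) (k : Letter n → ℕ) :
    act σ (countWeight k) = countWeight (k ∘ (σ : Equiv.Perm (Letter n))) := by
  ext i
  have h := weylGroup_swap σ (Sum.inl i)
  rw [Sum.swap_inl] at h
  rw [act_apply, countWeight, Function.comp_apply, Function.comp_apply, h]
  cases (σ : Equiv.Perm (Letter n)) (Sum.inl i) <;> simp [oddExt, countWeight]

theorem sum_piAntidiag_comp {n : ℕ} {A : Type*} [AddCommMonoid A] (π : Equiv.Perm (Letter n))
    (r : ℕ) (Q : Weight n → A) :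
    ∑ k ∈ Finset.piAntidiag Finset.univ r, Q (countWeight (k ∘ π)) =
      ∑ k ∈ Finset.piAntidiag Finset.univ r, Q (countWeight k) := by
  refine Finset.sum_bij (fun k _ => k ∘ π) (fun k hk => ?_) (fun k _ k' _ h => ?_)
    (fun k hk => ⟨k ∘ π.symm, ?_, ?_⟩) fun k _ => rfl
  · simp only [Finset.mem_piAntidiag, Finset.mem_univ, implies_true, and_true,
      Function.comp_apply] at hk ⊢
    rw [← hk]
    exact Equiv.sum_comp π k
  · exact π.surjective.injective_comp_right h
  · simp only [Finset.mem_piAntidiag, Finset.mem_univ, implies_true, and_true,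
      Function.comp_apply] at hk ⊢
    rw [← hk]
    exact Equiv.sum_comp π.symm k
  · ext x; simp

/-- The set of letter weights is stable under `W_n` and under negation, which exchanges barred and
unbarred letters. -/
theorem sum_act_countWeight {n : ℕ} {A : Type*} [AddCommMonoid A] (σ : weylGroup n)
    (r : ℕ) (Q : Weight n → A) :
    ∑ k ∈ Finset.piAntidiag Finset.univ r, Q (-countWeight k) =
      ∑ k ∈ Finset.piAntidiag Finset.univ r, Q (act σ (countWeight k)) := by
  simp only [act_countWeight]
  rw [sum_piAntidiag_comp, ← sum_piAntidiag_comp (Equiv.sumComm (Fin n) (Fin n))]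
  refine Finset.sum_congr rfl fun k _ => congrArg Q ?_
  ext j
  simp [countWeight]

/-- After shifting `β` by `ν + wt k`, all dependence on `k` lies in the coefficient of `y`, and the
remaining sum folds along the dot action. -/
theorem linExt_eq_finsum_dominant {n : ℕ} {A : Type*} [AddCommGroup A] {S : Weight n → A}
    (hS : Antisymm S) (y : GroupRing n) (ν : Weight n) (r : ℕ) :
    linExt (fun β => ∑ k ∈ Finset.piAntidiag Finset.univ r,
      S (ν + β + countWeight k + rho n)) y =
    ∑ᶠ γ : DominantWeight n, (∑ k ∈ Finset.piAntidiag Finset.univ r, ∑ σ : weylGroup n,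
      sgn σ * y.coeff (act σ (γ.1 + countWeight k + rho n) - (ν + rho n))) • S (γ.1 + rho n) := by
  have hfin : ∀ (w : Weight n) (f : Weight n → A),
      (Function.support fun β => y.coeff (β - w) • f β).Finite := by
    intro w f
    refine ((y.coeff.support.finite_toSet).preimage (f := fun β => β - w)
      (sub_left_injective.injOn)).subset fun β hβ => ?_
    rw [Set.mem_preimage, Finset.mem_coe, Finsupp.mem_support_iff]
    intro h
    simp [h] at hβ
  have h1 : linExt (fun β => ∑ k ∈ Finset.piAntidiag Finset.univ r,
      S (ν + β + countWeight k + rho n)) y =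
      ∑ᶠ β, ∑ k ∈ Finset.piAntidiag Finset.univ r,
        y.coeff (β - (ν + countWeight k)) • S (β + rho n) := by
    rw [linExt_apply, finsum_sum_comm _ _ fun k _ => hfin _ _]
    simp only [Finset.smul_sum]
    rw [finsum_sum_comm]
    · refine Finset.sum_congr rfl fun k _ => ?_
      refine Eq.trans ?_ (finsum_comp_equiv (Equiv.addRight (ν + countWeight k)))
      refine finsum_congr fun β => ?_
      simp only [Equiv.coe_addRight, add_sub_cancel_right]
      congr 2
      abel
    · intro k _
      have := hfin 0 fun β => S (ν + β + countWeight k + rho n)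
      simp only [sub_zero] at this
      exact this
  rw [h1, finsum_eq_finsum_dominant hS]
  · refine finsum_congr fun γ => ?_
    simp only [dotMap, sub_add_cancel, hS.map_act]
    rw [Finset.sum_comm, Finset.sum_smul]
    simp only [Finset.sum_smul]
    rw [Finset.sum_comm, Finset.sum_comm (s := Finset.piAntidiag _ _)]
    refine Finset.sum_congr rfl fun σ _ => ?_
    -- Folding leaves `-wt k` outside `σ`; replacing it by `σ(wt k)` lets it join `γ + ρ` under `σ`,
    -- as in the definition of `K_{γ + wt k, ν}`.
    have h2 := sum_act_countWeight σ r fun w =>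
      (sgn σ * y.coeff (act σ (γ.1 + rho n) + w - (ν + rho n))) • S (γ.1 + rho n)
    refine Eq.trans ?_ (h2.trans ?_)
    · refine Finset.sum_congr rfl fun k _ => ?_
      rw [smul_smul, mul_comm]
      congr 3
      abel
    · refine Finset.sum_congr rfl fun k _ => ?_
      rw [← act_add]
      congr 5
      abel
  · refine Set.Finite.subset (Set.Finite.biUnion (Finset.finite_toSet
      (Finset.piAntidiag Finset.univ r)) fun k _ => hfin (ν + countWeight k)
        fun β => S (β + rho n)) fun β hβ => ?_
    obtain ⟨k, hk, hne⟩ := Finset.exists_ne_zero_of_sum_ne_zero hβ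
    exact Set.mem_biUnion (Finset.mem_coe.mpr hk) hne
  · intro β hβ
    simp [hβ]

/-- The folding formula with Kostka-Foulkes polynomials as coefficients. -/
theorem linExt_kostantSeries {n : ℕ} (hn : 1 ≤ n) {A : Type*} [AddCommGroup A] {S : Weight n → A}
    (hS : Antisymm S) (mu : Weight n) (a r : ℕ) :
    linExt (fun β => ∑ k ∈ Finset.piAntidiag Finset.univ r,
      S (mu + β + countWeight k + rho n)) (PowerSeries.coeff a (kostantSeries n)) =
    ∑ᶠ γ : DominantWeight n, PowerSeries.coeff a (sumOverComponents γ.1 (rowWeight n r)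
      (fun lam => kostkaFoulkes lam mu)) • S (γ.1 + rho n) := by
  rw [linExt_eq_finsum_dominant hS]
  refine finsum_congr fun γ => ?_
  simp only [kostkaFoulkes_eq]
  rw [sumOverComponents_rowWeight_of_antisymm hn γ.2 r (antisymm_kostkaSum mu), map_sum]
  simp only [coeff_kostkaSum]

/-- A coefficient of the Kostant series has finite support, and for fixed `k` and `σ` the exponent
determines `γ`. -/
theorem finite_coeff_sumOverComponents {n : ℕ} (hn : 1 ≤ n) (mu : Weight n) (a r : ℕ) :
    {γ : DominantWeight n | PowerSeries.coeff a (sumOverComponents γ.1 (rowWeight n r)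
      (fun lam => kostkaFoulkes lam mu)) ≠ 0}.Finite := by
  have hfin : ∀ (k : Letter n → ℕ) (σ : weylGroup n),
      {γ : DominantWeight n | (PowerSeries.coeff a (kostantSeries n)).coeff
        (act σ (γ.1 + countWeight k + rho n) - (mu + rho n)) ≠ 0}.Finite := by
    intro k σ
    refine ((Finsupp.hasFiniteSupport (PowerSeries.coeff a (kostantSeries n)).coeff).preimage
      (f := fun γ : DominantWeight n =>
        act σ (γ.1 + countWeight k + rho n) - (mu + rho n)) ?_)
    intro γ _ γ' _ h
    exact Subtype.ext (add_right_cancel (add_right_cancel (act_injective σ (sub_left_injective h))))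
  refine Set.Finite.subset (Set.Finite.biUnion (Finset.finite_toSet
    (Finset.piAntidiag Finset.univ r)) fun k _ => Set.finite_iUnion fun σ => hfin k σ) ?_
  intro γ hγ
  simp only [kostkaFoulkes_eq] at hγ
  rw [Set.mem_ofPred_eq, sumOverComponents_rowWeight_of_antisymm hn γ.2 r (antisymm_kostkaSum mu),
    map_sum] at hγ
  obtain ⟨k, hk, hne⟩ := Finset.exists_ne_zero_of_sum_ne_zero hγ
  rw [coeff_kostkaSum] at hne
  obtain ⟨σ, -, hne'⟩ := Finset.exists_ne_zero_of_sum_ne_zero hne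
  exact Set.mem_biUnion (Finset.mem_coe.mpr hk) (Set.mem_iUnion.mpr ⟨σ, right_ne_zero_of_mul hne'⟩)

/-! ### Products of geometric series -/

theorem invOfUnit_one_sub {R : Type*} [CommRing R] (a : R) :
    PowerSeries.invOfUnit (1 - PowerSeries.X * PowerSeries.C a) 1 =
      PowerSeries.mk fun k => a ^ k := by
  have h1 : (1 - PowerSeries.X * PowerSeries.C a) *
      PowerSeries.invOfUnit (1 - PowerSeries.X * PowerSeries.C a) 1 = 1 :=
    PowerSeries.mul_invOfUnit _ _ (by simp)
  have h2 : (1 - PowerSeries.X * PowerSeries.C a) * PowerSeries.mk (fun k => a ^ k) = 1 := by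
    ext k
    rw [sub_mul, one_mul, map_sub, PowerSeries.coeff_mk, mul_assoc]
    cases k with
    | zero => simp
    | succ k =>
      rw [PowerSeries.coeff_succ_X_mul, PowerSeries.coeff_C_mul, PowerSeries.coeff_mk,
        PowerSeries.coeff_one, if_neg (Nat.succ_ne_zero k)]
      ring
  exact (left_inv_eq_right_inv (by rwa [mul_comm] at h1) h2)

theorem coeff_prod_invOfUnit {R ι : Type*} [CommRing R] [DecidableEq ι] (s : Finset ι) (a : ι → R)
    (N : ℕ) :
    PowerSeries.coeff N (∏ i ∈ s,
      PowerSeries.invOfUnit (1 - PowerSeries.X * PowerSeries.C (a i)) 1) =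
      ∑ k ∈ Finset.piAntidiag s N, ∏ i ∈ s, a i ^ k i := by
  simp only [invOfUnit_one_sub]
  rw [PowerSeries.coeff_prod]
  simp only [PowerSeries.coeff_mk]
  refine Finset.sum_bij (fun l _ => ⇑l) (fun l hl => ?_) (fun l _ l' _ h => DFunLike.coe_injective h)
    (fun k hk => ?_) fun l _ => rfl
  · rw [Finset.mem_finsuppAntidiag] at hl
    rw [Finset.mem_piAntidiag]
    exact ⟨hl.1, fun i hi => hl.2 (Finsupp.mem_support_iff.mpr hi)⟩
  · rw [Finset.mem_piAntidiag] at hk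
    refine ⟨Finsupp.onFinset s k hk.2, ?_, rfl⟩
    rw [Finset.mem_finsuppAntidiag]
    exact ⟨hk.1, Finsupp.support_onFinset_subset⟩

theorem prod_xpow {n : ℕ} {ι : Type*} (s : Finset ι) (a : ι → Weight n) (k : ι → ℕ) :
    ∏ i ∈ s, xpow (a i) ^ k i = xpow (∑ i ∈ s, k i • a i) := by
  simp only [xpow, AddMonoidAlgebra.single_pow, one_pow, AddMonoidAlgebra.prod_single,
    Finset.prod_const_one]

theorem xpow_mul {n : ℕ} (β γ : Weight n) : xpow β * xpow γ = xpow (β + γ) := by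
  simp [xpow, AddMonoidAlgebra.single_mul_single]

theorem coeff_kostantSeries (n N : ℕ) :
    PowerSeries.coeff N (kostantSeries n) =
      ∑ k ∈ Finset.piAntidiag (posRoots n) N, xpow (∑ α ∈ posRoots n, k α • α) := by
  rw [kostantSeries, coeff_prod_invOfUnit]
  exact Finset.sum_congr rfl fun k _ => prod_xpow _ _ k

/-- Raising operators become multiplication in the group ring, where the Kostant series factors over
the roots. -/
theorem coeff_hallLittlewood {n : ℕ} (μ : Weight n) (N : ℕ) :
    PowerSeries.coeff N (hallLittlewood μ) =
      linExt schur (xpow μ * PowerSeries.coeff N (kostantSeries n)) := by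
  rw [hallLittlewood, PowerSeries.coeff_mk, coeff_kostantSeries, Finset.mul_sum, map_sum]
  simp only [xpow_mul, linExt_xpow]

/-! ### The positive roots of type `C_{n+1}` -/

/-- The weight of a letter. -/
def letterWeight {n : ℕ} : Letter n → Weight n := Sum.elim basisVec fun i => -basisVec i

theorem letterWeight_injective {n : ℕ} : Function.Injective (letterWeight (n := n)) := by
  intro x y h
  rcases x with i | i <;> rcases y with j | j <;>
    simp only [letterWeight, Sum.elim_inl, Sum.elim_inr, basisVec] at h <;>
    have h' := congrFun h i <;>
    by_cases hij : i = j <;> simp [hij] at h' ⊢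

theorem sum_letterWeight {n : ℕ} (k : Letter n → ℕ) :
    ∑ x, k x • letterWeight x = countWeight k := by
  ext j
  simp [Fintype.sum_sum_type, letterWeight, countWeight, basisVec, Finset.sum_apply,
    Pi.single_apply, sub_eq_add_neg]

/-- Embed the weights of type `C_n` in those of type `C_{n+1}`. -/
def snocHom (n : ℕ) : Weight n × ℤ →+ Weight (n + 1) where
  toFun p := Fin.snoc p.1 p.2
  map_zero' := by ext j; cases j using Fin.lastCases <;> simp
  map_add' p q := by ext j; cases j using Fin.lastCases <;> simp

theorem snocHom_injective (n : ℕ) : Function.Injective (snocHom n) := by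
  rintro ⟨p, a⟩ ⟨q, b⟩ h
  obtain ⟨h1, h2⟩ := Fin.snoc_inj (α := fun _ => ℤ).mp h
  exact Prod.ext h1 h2

theorem basisVec_castSucc {n : ℕ} (i : Fin n) :
    (basisVec i.castSucc : Weight (n + 1)) = snocHom n (basisVec i, 0) := by
  ext j
  cases j using Fin.lastCases with
  | last => simp [basisVec, snocHom, (Fin.castSucc_lt_last i).ne']
  | cast j => simp [basisVec, snocHom, Pi.single_apply]

theorem basisVec_last {n : ℕ} : (basisVec (Fin.last n) : Weight (n + 1)) = snocHom n (0, 1) := by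
  ext j
  cases j using Fin.lastCases with
  | last => simp [basisVec, snocHom]
  | cast j => simp [basisVec, snocHom, (Fin.castSucc_lt_last j).ne]

theorem mem_posRoots {n : ℕ} {α : Weight n} :
    α ∈ posRoots n ↔ (∃ i j, j < i ∧ basisVec i - basisVec j = α) ∨
      (∃ i j, j < i ∧ basisVec i + basisVec j = α) ∨ ∃ i, (2 : ℤ) • basisVec i = α := by
  simp [posRoots]

/-- The roots with last coordinate `1` are indexed by the letters of type `C_n`; this is how
`B((r))` enters. -/
theorem posRoots_succ (n : ℕ) :
    posRoots (n + 1) = ((posRoots n).image (fun α => snocHom n (α, 0)) ∪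
      Finset.univ.image (fun x => snocHom n (letterWeight x, 1))) ∪ {snocHom n (0, 2)} := by
  ext α
  simp only [mem_posRoots, Finset.mem_union, Finset.mem_image, Finset.mem_univ, true_and,
    Finset.mem_singleton, Fin.exists_fin_succ', Fin.castSucc_lt_castSucc_iff, basisVec_castSucc,
    basisVec_last, ← map_sub, ← map_add, ← map_zsmul, Prod.mk_add_mk, Prod.mk_sub_mk,
    Prod.smul_mk, Fin.castSucc_lt_last, lt_irrefl, (Fin.castSucc_lt_last _).not_gt, false_and,
    or_false, Sum.exists, letterWeight, Sum.elim_inl, Sum.elim_inr]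
  simp only [sub_zero, zero_sub, add_zero, zero_add, smul_zero, smul_eq_mul, mul_one]
  constructor
  · rintro ((⟨i, j, h, e⟩ | ⟨i, e⟩) | (⟨i, j, h, e⟩ | ⟨i, e⟩) | (⟨i, e⟩ | e))
    · exact .inl (.inl ⟨_, .inl ⟨i, j, h, rfl⟩, e⟩)
    · exact .inl (.inr (.inr ⟨i, e⟩))
    · exact .inl (.inl ⟨_, .inr (.inl ⟨i, j, h, rfl⟩), e⟩)
    · exact .inl (.inr (.inl ⟨i, e⟩))
    · exact .inl (.inl ⟨_, .inr (.inr ⟨i, rfl⟩), e⟩)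
    · exact .inr e.symm
  · rintro ((⟨_, (⟨i, j, h, rfl⟩ | ⟨i, j, h, rfl⟩ | ⟨i, rfl⟩), e⟩ | ⟨i, e⟩ | ⟨i, e⟩) | e)
    · exact .inl (.inl ⟨i, j, h, e⟩)
    · exact .inr (.inl (.inl ⟨i, j, h, e⟩))
    · exact .inr (.inr (.inl ⟨i, e⟩))
    · exact .inr (.inl (.inr ⟨i, e⟩))
    · exact .inl (.inr ⟨i, e⟩)
    · exact .inr (.inr (.inr e.symm))

theorem kostantSeries_succ (n : ℕ) :
    kostantSeries (n + 1) =
      PowerSeries.invOfUnit (1 - PowerSeries.X * PowerSeries.C (xpow (snocHom n (0, 2)))) 1 *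
      ((∏ x : Letter n, PowerSeries.invOfUnit
        (1 - PowerSeries.X * PowerSeries.C (xpow (snocHom n (letterWeight x, 1)))) 1) *
      ∏ α ∈ posRoots n, PowerSeries.invOfUnit
        (1 - PowerSeries.X * PowerSeries.C (xpow (snocHom n (α, 0)))) 1) := by
  have hd1 : Disjoint ((posRoots n).image (fun α => snocHom n (α, 0)))
      (Finset.univ.image (fun x : Letter n => snocHom n (letterWeight x, 1))) := by
    rw [Finset.disjoint_left]
    intro β h h'
    obtain ⟨α, -, rfl⟩ := Finset.mem_image.mp h
    obtain ⟨x, -, hx⟩ := Finset.mem_image.mp h'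
    have := congrArg Prod.snd (snocHom_injective n hx)
    simp at this
  have hd2 : Disjoint ((posRoots n).image (fun α => snocHom n (α, 0)) ∪
      Finset.univ.image (fun x : Letter n => snocHom n (letterWeight x, 1)))
      {snocHom n (0, 2)} := by
    rw [Finset.disjoint_singleton_right, Finset.mem_union, Finset.mem_image, Finset.mem_image]
    rintro (⟨α, -, h⟩ | ⟨x, -, h⟩) <;>
      simpa using congrArg Prod.snd (snocHom_injective n h)
  rw [kostantSeries, posRoots_succ, Finset.prod_union hd2, Finset.prod_union hd1,
    Finset.prod_image, Finset.prod_image, Finset.prod_singleton]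
  · ring
  · intro x _ y _ h
    exact letterWeight_injective (congrArg Prod.fst (snocHom_injective n h))
  · intro x _ y _ h
    exact congrArg Prod.fst (snocHom_injective n h)

theorem coeff_prod_snocHom {n : ℕ} {ι : Type*} [DecidableEq ι] (s : Finset ι) (a : ι → Weight n)
    (c : ℤ) (N : ℕ) :
    PowerSeries.coeff N (∏ i ∈ s, PowerSeries.invOfUnit
      (1 - PowerSeries.X * PowerSeries.C (xpow (snocHom n (a i, c)))) 1) =
      ∑ k ∈ Finset.piAntidiag s N, xpow (snocHom n (∑ i ∈ s, k i • a i, N * c)) := by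
  rw [coeff_prod_invOfUnit]
  refine Finset.sum_congr rfl fun k hk => ?_
  rw [prod_xpow]
  congr 1
  simp only [← map_nsmul, ← map_sum]
  congr 1
  refine Prod.ext ?_ ?_
  · simp [Prod.fst_sum]
  · rw [← (Finset.mem_piAntidiag.mp hk).1]
    simp [Prod.snd_sum, Finset.sum_mul]

/-- `m` is the exponent of the long root and `r` the total exponent of the roots with last
coordinate `1`, whence the shift `r + 2m`; `k` distributes `r` among the letters. -/
theorem coeff_hallLittlewood_succ {n : ℕ} (μ : Weight (n + 1)) (N : ℕ) :
    PowerSeries.coeff N (hallLittlewood μ) =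
      ∑ m ∈ Finset.range (N + 1), ∑ r ∈ Finset.range (N - m + 1),
        linExt (fun β => ∑ k ∈ Finset.piAntidiag Finset.univ r,
          schur (Fin.snoc (Fin.init μ + β + countWeight k)
            (μ (Fin.last n) + r + 2 * m) : Weight (n + 1)))
          (PowerSeries.coeff (N - m - r) (kostantSeries n)) := by
  rw [coeff_hallLittlewood, kostantSeries_succ, PowerSeries.coeff_mul,
    Finset.Nat.sum_antidiagonal_eq_sum_range_succ_mk, Finset.mul_sum, map_sum]
  refine Finset.sum_congr rfl fun m _ => ?_
  rw [PowerSeries.coeff_mul, Finset.Nat.sum_antidiagonal_eq_sum_range_succ_mk, Finset.mul_sum,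
    Finset.mul_sum, map_sum]
  refine Finset.sum_congr rfl fun r _ => ?_
  have hμ : μ = snocHom n (Fin.init μ, μ (Fin.last n)) := (Fin.snoc_init_self μ).symm
  have hlong : PowerSeries.coeff m (PowerSeries.invOfUnit
      (1 - PowerSeries.X * PowerSeries.C (xpow (snocHom n (0, 2)))) 1) =
      xpow (snocHom n (0, (m : ℤ) * 2)) := by
    rw [invOfUnit_one_sub, PowerSeries.coeff_mk]
    simp only [xpow, AddMonoidAlgebra.single_pow, one_pow, ← map_nsmul]
    simp
  rw [hlong, coeff_prod_snocHom, coeff_prod_snocHom, coeff_kostantSeries, map_sum]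
  simp only [linExt_xpow]
  rw [Finset.sum_comm, Finset.sum_mul, Finset.mul_sum, Finset.mul_sum, map_sum]
  refine Finset.sum_congr rfl fun k _ => ?_
  rw [Finset.mul_sum, Finset.mul_sum, Finset.mul_sum, map_sum]
  refine Finset.sum_congr rfl fun k' _ => ?_
  rw [hμ, xpow_mul, xpow_mul, xpow_mul, linExt_xpow, ← map_add, ← map_add, ← map_add, ← hμ,
    sum_letterWeight]
  congr 1
  change _ = snocHom n (Fin.init μ + ∑ α ∈ posRoots n, k' α • α + countWeight k,
    μ (Fin.last n) + r + 2 * m)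
  refine congrArg (snocHom n) (Prod.ext ?_ ?_)
  · simp only [Prod.mk_add_mk]
    abel
  · simp only [Prod.mk_add_mk]
    ring

/-! ### The Morris-type recurrence -/

theorem finsum_prod_eq_sum_range {Γ A : Type*} [AddCommMonoid A] (G : Γ × ℕ × ℕ → A) (N : ℕ)
    (hfin : (Function.support G).Finite)
    (h0 : ∀ γ r m, N < m + r → G (γ, r, m) = 0) :
    ∑ᶠ t, G t = ∑ m ∈ Finset.range (N + 1), ∑ r ∈ Finset.range (N - m + 1),
      ∑ᶠ γ, G (γ, r, m) := by
  rw [← finsum_comp_equiv (Equiv.prodComm (ℕ × ℕ) Γ), finsum_curry]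
  · simp only [Equiv.prodComm_apply, Prod.swap_prod_mk]
    rw [finsum_eq_sum_of_support_subset (s := Finset.range (N + 1) ×ˢ Finset.range (N + 1)),
      Finset.sum_product_right]
    · refine Finset.sum_congr rfl fun m hm => (Finset.sum_subset ?_ fun r _ hr => ?_).symm
      · exact Finset.range_mono (by omega)
      · rw [Finset.mem_range] at hm hr
        exact finsum_eq_zero_of_forall_eq_zero fun γ => h0 γ r m (by omega)
    · rintro ⟨r, m⟩ h
      simp only [Finset.coe_product, Finset.coe_range, Set.mem_prod, Set.mem_Iio]
      by_contra hc
      exact h (finsum_eq_zero_of_forall_eq_zero fun γ => h0 γ r m (by omega))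
  · exact hfin.preimage (Equiv.injective _).injOn

end TypeC

end

theorem mainTheorem1 (n : ℕ) (hn : 1 ≤ n) (mu : Weight (n + 1)) (hmu : IsDominant mu) :
    HasFormalSum
      (fun t : DominantWeight n × ℕ × ℕ =>
        match t with
        | (γ, r, m) =>
          (PowerSeries.X : PowerSeries (FracField (n + 1))) ^ (m + r) *
            PowerSeries.map (Int.castRingHom (FracField (n + 1)))
              (sumOverComponents γ.1 (rowWeight n r)
                (fun lam => kostkaFoulkes lam (Fin.init mu))) *
            PowerSeries.C
              (schur (Fin.snoc γ.1 (mu (Fin.last n) + (r : ℤ) + 2 * (m : ℤ)) : Weight (n + 1))))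
      (hallLittlewood mu) := by
  intro N
  have hcoeff : ∀ (γ : DominantWeight n) (r m : ℕ),
      PowerSeries.coeff N ((PowerSeries.X : PowerSeries (FracField (n + 1))) ^ (m + r) *
        PowerSeries.map (Int.castRingHom (FracField (n + 1)))
          (sumOverComponents γ.1 (rowWeight n r)
            (fun lam => kostkaFoulkes lam (Fin.init mu))) *
        PowerSeries.C
          (schur (Fin.snoc γ.1 (mu (Fin.last n) + (r : ℤ) + 2 * (m : ℤ)) : Weight (n + 1)))) =
      if m + r ≤ N then
        PowerSeries.coeff (N - (m + r)) (sumOverComponents γ.1 (rowWeight n r)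
          (fun lam => kostkaFoulkes lam (Fin.init mu))) •
        schur (Fin.snoc γ.1 (mu (Fin.last n) + (r : ℤ) + 2 * (m : ℤ)) : Weight (n + 1))
      else 0 := by
    intro γ r m
    rw [mul_assoc, PowerSeries.coeff_X_pow_mul']
    split_ifs
    · rw [PowerSeries.coeff_mul_C, PowerSeries.coeff_map, zsmul_eq_mul]
      rfl
    · rfl
  simp only [hcoeff]
  have hfin : {t : DominantWeight n × ℕ × ℕ | (if t.2.2 + t.2.1 ≤ N then
      PowerSeries.coeff (N - (t.2.2 + t.2.1)) (sumOverComponents t.1.1 (rowWeight n t.2.1)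
        (fun lam => kostkaFoulkes lam (Fin.init mu))) •
      schur (Fin.snoc t.1.1 (mu (Fin.last n) + (t.2.1 : ℤ) + 2 * (t.2.2 : ℤ)) : Weight (n + 1))
      else 0) ≠ 0}.Finite := by
    refine Set.Finite.subset (Set.Finite.prod (Set.Finite.biUnion (Finset.finite_toSet
      (Finset.range (N + 1) ×ˢ Finset.range (N + 1))) fun p _ =>
        finite_coeff_sumOverComponents hn (Fin.init mu) p.1 p.2)
      (Finset.finite_toSet (Finset.range (N + 1) ×ˢ Finset.range (N + 1)))) ?_
    rintro ⟨γ, r, m⟩ ht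
    rw [Set.mem_ofPred_eq] at ht
    split_ifs at ht with h
    · dsimp only at h
      -- The pair records the power of `q` left for the Kostka-Foulkes factor and the row length;
      -- for each such pair only finitely many `γ` occur.
      refine Set.mem_prod.mpr ⟨Set.mem_biUnion (x := (N - (m + r), r)) ?_ ?_, ?_⟩
      · simp; omega
      · exact fun h0 => ht (by simp only [h0, zero_smul])
      · simp; omega
    · exact absurd rfl ht
  refine ⟨hfin, ?_⟩
  rw [coeff_hallLittlewood_succ]
  refine Eq.trans ?_ (finsum_prod_eq_sum_range _ N hfin fun γ r m h => if_neg (by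
    dsimp only; omega)).symm
  refine Finset.sum_congr rfl fun m hm => Finset.sum_congr rfl fun r hr => ?_
  rw [Finset.mem_range] at hm hr
  simp only [schur_snoc, if_pos (show m + r ≤ N by omega), Nat.sub_sub]
  -- The frozen coordinate is `μ_{\overline n} + r + 2m + (n + 1)`, the last term being the top
  -- entry of `ρ` in type `C_{n+1}`.
  exact linExt_kostantSeries hn (antisymm_schurRho_snoc _) (Fin.init mu) (N - (m + r)) r
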